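/- Let $R$ be an integral domain with quotient field $K$. For subsets $A,B\subset K$ put $(A:B)=\{z\in K\mid zB\subset A\}$. Suppose that $R$ is seminormal, that is, every $x\in K$ for which there is some $N\in\mathbb N$ with $x^n\in R$ for all $n\ge N$ lies in $R$. A non-zero ideal $I$ of $R$ is called divisorial if $I=(R:(R:I))$, and stable if it is invertible as an ideal of the overring $E=(I:I)$ of $R$, that is, $I\,(E:I)=E$. The domain $R$ is called divisorial if every non-zero ideal of $R$ is divisorial; finitely stable if every non-zero finitely generated ideal of $R$ is stable; and a Mori domain if it satisfies the ascending chain condition on non-zero divisorial ideals. Then the following statements are equivalent. (a) Every ideal of $R$ is $2$-generated, that is, of the form $aR+bR$ with $a,b\in R$. (b) $R$ is a divisorial Mori domain. (c) $R$ is a finitely stable Mori domain. -/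

import Mathlib

open IsLocalization (coeSubmodule)

/-- `R` is seminormal, seen inside its quotient field `K`: every `x` in `K` all of whose
sufficiently large powers lie in `R` is itself in `R`. -/
def IsSeminormalDomain (R K : Type*) [CommRing R] [Field K] [Algebra R K] : Prop :=
  ∀ x : K, (∃ N : ℕ, ∀ n ≥ N, x ^ n ∈ (algebraMap R K).range) → x ∈ (algebraMap R K).range

/-- The ideal `I` of `R` is divisorial: `(I⁻¹)⁻¹ = I`, where `A⁻¹ = (R : A) = {z ∈ K | z A ⊆ R}`.
In `Submodule R K`, `A / B` is `{z | ∀ b ∈ B, z * b ∈ A}`, `1` is the image of `R` in `K`, and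
`coeSubmodule K I` is the image of `I` in `K`. -/
def IsDivisorialIdeal {R : Type*} (K : Type*) [CommRing R] [Field K] [Algebra R K]
    (I : Ideal R) : Prop :=
  (1 / (1 / coeSubmodule K I) : Submodule R K) = coeSubmodule K I

/-- `R` is divisorial: every non-zero ideal is divisorial. -/
def IsDivisorialDomain (R K : Type*) [CommRing R] [Field K] [Algebra R K] : Prop :=
  ∀ I : Ideal R, I ≠ ⊥ → IsDivisorialIdeal K I

/-- `R` is a Mori domain: it satisfies the ascending chain condition on non-zero divisorial
ideals. -/
def IsMoriDomain (R K : Type*) [CommRing R] [Field K] [Algebra R K] : Prop :=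
  ∀ f : ℕ → Ideal R, Monotone f → (∀ n, f n ≠ ⊥ ∧ IsDivisorialIdeal K (f n)) →
    ∃ n, ∀ m ≥ n, f m = f n

/-- The ideal `I` of `R` is stable: with `E = (I : I) = {z ∈ K | z I ⊆ I}`, an overring of `R` of
which `I` is an ideal, `I` is invertible in `E`, that is, `I (E : I) = E`. (The product of two
`E`-submodules of `K` does not depend on whether it is formed over `R` or over `E`.) -/
def IsStableIdeal {R : Type*} (K : Type*) [CommRing R] [Field K] [Algebra R K]
    (I : Ideal R) : Prop :=
  coeSubmodule K I * ((coeSubmodule K I / coeSubmodule K I) / coeSubmodule K I) =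
    coeSubmodule K I / coeSubmodule K I

/-- `R` is finitely stable: every non-zero finitely generated ideal is stable. -/
def IsFinitelyStableDomain (R K : Type*) [CommRing R] [Field K] [Algebra R K] : Prop :=
  ∀ I : Ideal R, I ≠ ⊥ → I.FG → IsStableIdeal K I

/-- The ideal `I` is 2-generated: `I = aR + bR` for some `a`, `b` (which may coincide or be zero). -/
def IsTwoGenerated {R : Type*} [CommRing R] (I : Ideal R) : Prop :=
  ∃ a b : R, I = Ideal.span {a, b}

/-!
For a nonzero maximal ideal `m` of `R` let `E = (m : m)` be its multiplier ring. All three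
properties are compared with one local condition, `IsStableQuadratic`: the ideal `m` is invertible
in `E`, and no `R`-module lies strictly between `R` and `E`. Seminormality enters only through
`isReduced_of_isSeminormalDomain`: the ring `E / m` is reduced. Under the local condition `E / m`
is therefore a reduced algebra of dimension at most two over `R / m`, so that every ideal of `E`
between `m` and `E` divides `m` (`exists_mul_eq_of_wcovBy`) and hence is invertible in `E`.

*The local condition implies (a) and (c) when `R` is Noetherian (of dimension one, for (a)).*
Noetherian induction shows that every ideal of `E` is invertible locally at `m`, and every nonzero
ideal `I` of `R` is then, locally at `m`, isomorphic to `R` or to `E` (`exists_local_generator`).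
This makes `I` stable, and generated by two elements locally at `m`; two global generators are
found by the Chinese remainder theorem (`isTwoGenerated_of_forall_isMaximal`).

*(a) implies (b).* The dimension is at most one because `m ^ 2 = c m` holds locally at `m` for some
`c ∈ m`, so that Krull's principal ideal theorem applies. As `E` is generated by two elements, no
module lies strictly between `R` and `m⁻¹`. Dualizing therefore does not increase the length of
modules, and all ideals are divisorial (`wcovBy_one_div_one_div`, `isDivisorialDomain_of_wcovBy`).

*(b) implies (c).* All ideals being divisorial, `R` is Noetherian, and no module lies strictly
between `R` and `m⁻¹`. If `A = m (E : m)` were a proper ideal of `E`, then `(E : A) = E`, so `m A`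
and `m` would have the same inverse, against Nakayama's lemma. So the local condition holds.

*(c) implies (a).* By the chain condition `m⁻¹ = J⁻¹` for some `J ⊆ m` of finite type. As `J` is
stable, `m = J E` is invertible in `E` (`exists_fg_eq_mul_multiplierRing`). Finite stability also
bounds the dimension of `E / m` by two (`exists_eq_add_mul_of_linesOfTrivialMultipliers`), so the
local condition holds and `m` is finitely generated. The chain condition on divisorial ideals now
shows that nonzero primes are maximal (`IsMoriDomain.dimensionLEOne`), and `R` is Noetherian by
Cohen's theorem.

All modules are `R`-submodules of `K`. "No module lies strictly between `A` and `B`", with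
`A = B` allowed, is expressed by `A ⩿ B`.
-/

namespace DivisorialStable

/-! ### Quotients of submodules of the quotient field -/

section Quotients

variable {R K : Type*} [CommRing R] [Field K] [Algebra R K]

lemma div_mul_le (A B : Submodule R K) : A / B * B ≤ A :=
  Submodule.le_div_iff_mul_le.mp le_rfl

lemma mul_mem_of_mem_div {A B : Submodule R K} {x y : K} (hx : x ∈ A / B) (hy : y ∈ B) :
    x * y ∈ A :=
  hx y hy

lemma div_anti (A : Submodule R K) {B C : Submodule R K} (h : B ≤ C) : A / C ≤ A / B :=
  fun _ hx y hy => hx y (h hy)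

lemma div_mono_left {A B : Submodule R K} (C : Submodule R K) (h : A ≤ B) : A / C ≤ B / C :=
  fun _ hx y hy => h (hx y hy)

lemma div_div_eq (A B C : Submodule R K) : A / B / C = A / (B * C) := by
  apply le_antisymm
  · rw [Submodule.le_div_iff_mul_le, mul_comm B C, ← mul_assoc]
    exact (mul_le_mul_left (div_mul_le _ _) _).trans (div_mul_le _ _)
  · rw [Submodule.le_div_iff_mul_le, Submodule.le_div_iff_mul_le, mul_assoc, mul_comm C B]
    exact div_mul_le _ _

lemma div_div_comm (A B C : Submodule R K) : A / B / C = A / C / B := by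
  rw [div_div_eq, div_div_eq, mul_comm]

lemma div_one_eq (A : Submodule R K) : A / 1 = A := by
  apply le_antisymm
  · simpa using div_mul_le A 1
  · rw [Submodule.le_div_iff_mul_le, mul_one]

lemma div_mul_of_mul_eq_one {U V : Submodule R K} (h : U * V = 1) (A B : Submodule R K) :
    A / (U * B) = V * (A / B) := by
  apply le_antisymm
  · have h1 : U * (A / (U * B)) ≤ A / B := by
      rw [Submodule.le_div_iff_mul_le]
      calc U * (A / (U * B)) * B = A / (U * B) * (U * B) := by ring
        _ ≤ A := div_mul_le _ _
    calc A / (U * B) = V * (U * (A / (U * B))) := by rw [← mul_assoc, mul_comm V, h, one_mul]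
      _ ≤ _ := mul_le_mul_right h1 _
  · rw [Submodule.le_div_iff_mul_le]
    calc V * (A / B) * (U * B) = (U * V) * (A / B * B) := by ring
      _ = A / B * B := by rw [h, one_mul]
      _ ≤ A := div_mul_le _ _

lemma one_le_div_self (N : Submodule R K) : 1 ≤ N / N := by
  rw [Submodule.le_div_iff_mul_le, one_mul]

lemma div_self_mul (N : Submodule R K) : N / N * N = N :=
  le_antisymm (div_mul_le _ _) (by simpa using mul_le_mul_left (one_le_div_self N) N)

lemma div_self_mul_div_self (N : Submodule R K) : N / N * (N / N) = N / N := by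
  apply le_antisymm
  · rw [Submodule.le_div_iff_mul_le, mul_assoc, div_self_mul, div_self_mul]
  · simpa using mul_le_mul_left (one_le_div_self N) (N / N)

lemma le_one_div_one_div (N : Submodule R K) : N ≤ 1 / (1 / N) := by
  rw [Submodule.le_div_iff_mul_le]
  exact Submodule.mul_one_div_le_one

lemma one_div_one_div_one_div (N : Submodule R K) : 1 / (1 / (1 / N)) = 1 / N :=
  le_antisymm (div_anti _ (le_one_div_one_div N)) (le_one_div_one_div _)

lemma span_mul_span_inv {d : K} (hd : d ≠ 0) :
    Submodule.span R {d} * Submodule.span R {d⁻¹} = 1 := by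
  rw [Submodule.span_mul_span, Set.singleton_mul_singleton, mul_inv_cancel₀ hd,
    Submodule.one_eq_span]

lemma mem_span_singleton_mul_iff {d x : K} {N : Submodule R K} :
    x ∈ Submodule.span R {d} * N ↔ ∃ n ∈ N, d * n = x :=
  Submodule.mem_span_singleton_mul

lemma algebraMap_mem_of_one_le {E : Submodule R K} (h : 1 ≤ E) (r : R) : algebraMap R K r ∈ E :=
  h (Submodule.algebraMap_mem r)

lemma algebraMap_mul_mem (N : Submodule R K) (r : R) {x : K} (hx : x ∈ N) :
    algebraMap R K r * x ∈ N := by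
  rw [← Algebra.smul_def]
  exact N.smul_mem r hx

lemma coeSubmodule_le_one (I : Ideal R) : coeSubmodule K I ≤ 1 := by
  rw [← IsLocalization.coeSubmodule_top]
  exact IsLocalization.coeSubmodule_mono K le_top

lemma coeSubmodule_comap {N : Submodule R K} (h : N ≤ 1) :
    coeSubmodule K (N.comap (Algebra.linearMap R K)) = N :=
  Submodule.map_comap_eq_of_le (by rwa [← Submodule.one_eq_range])

end Quotients

section Domain

variable {R K : Type*} [CommRing R] [Field K] [Algebra R K] [IsFractionRing R K]

lemma algebraMap_mem_coeSubmodule {I : Ideal R} {r : R} :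
    algebraMap R K r ∈ coeSubmodule K I ↔ r ∈ I := by
  rw [IsLocalization.mem_coeSubmodule]
  constructor
  · rintro ⟨s, hs, h⟩
    rwa [← IsFractionRing.injective R K h]
  · exact fun h => ⟨r, h, rfl⟩

lemma coeSubmodule_ne_bot {I : Ideal R} (h : I ≠ ⊥) : coeSubmodule K I ≠ ⊥ := by
  rw [← IsLocalization.coeSubmodule_bot]
  exact fun h' => h (IsFractionRing.coeSubmodule_injective R K h')

lemma exists_algebraMap_mem_ne_zero {N : Submodule R K} (h : N ≠ ⊥) :
    ∃ r : R, r ≠ 0 ∧ algebraMap R K r ∈ N := by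
  obtain ⟨x, hx, hx0⟩ := N.ne_bot_iff.mp h
  obtain ⟨a, b, hb, rfl⟩ := IsFractionRing.div_surjective (A := R) x
  have hb0 : algebraMap R K b ≠ 0 := fun h => hx0 (by rw [h, div_zero])
  refine ⟨a, fun h => hx0 (by simp [h]), ?_⟩
  have := algebraMap_mul_mem N b hx
  rwa [mul_div_cancel₀ _ hb0] at this

end Domain

/-- Nakayama's lemma for an ideal `A` of an overring `E` of `R`, phrased with `R`-submodules
of `K`. -/
lemma one_mem_of_le_mul {R K : Type*} [CommRing R] [Field K] [Algebra R K]
    {E A N : Submodule R K} (h1 : 1 ≤ E) (hE : E * E ≤ E) (hAE : A ≤ E) (hEA : E * A ≤ A)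
    (hN : N.FG) (hN0 : N ≠ ⊥) (h : N ≤ A * N) : (1 : K) ∈ A := by
  let S : Subalgebra R K := E.toSubalgebra (Submodule.one_le.mp h1)
    fun x y hx hy => hE (Submodule.mul_mem_mul hx hy)
  let A' : Ideal S :=
    { carrier := {e | (e : K) ∈ A}
      zero_mem' := A.zero_mem
      add_mem' := fun ha hb => A.add_mem ha hb
      smul_mem' := fun c x hx => hEA (Submodule.mul_mem_mul c.2 hx) }
  obtain ⟨s, hs⟩ := hN
  have hfg : (Submodule.span S (N : Set K)).FG := by
    refine ⟨s, ?_⟩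
    rw [← hs, Submodule.span_span_of_tower]
  have hle : Submodule.span S (N : Set K) ≤ A' • Submodule.span S (N : Set K) := by
    rw [Submodule.span_le]
    intro n hn
    refine Submodule.mul_induction_on (h hn) ?_ ?_
    · intro a ha b hb
      exact Submodule.smul_mem_smul (r := (⟨a, hAE ha⟩ : S)) ha (Submodule.subset_span hb)
    · exact fun x y hx hy => Submodule.add_mem _ hx hy
  obtain ⟨r, hr, hr0⟩ :=
    Submodule.exists_sub_one_mem_and_smul_eq_zero_of_fg_of_le_smul A' _ hfg hle
  obtain ⟨n, hn, hn0⟩ := N.ne_bot_iff.mp hN0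
  have hrn : (r : K) * n = 0 := hr0 n (Submodule.subset_span hn)
  have : (r : K) = 0 := (mul_eq_zero.mp hrn).resolve_right hn0
  have hr' : (r : K) - 1 ∈ A := hr
  rw [this, zero_sub] at hr'
  simpa using A.neg_mem hr'

/-! ### The multiplier ring of a maximal ideal -/

section Multiplier

variable {R : Type*} (K : Type*) [CommRing R] [Field K] [Algebra R K]

/-- The multiplier ring `(m : m)` of an ideal `m`, as an `R`-submodule of `K`. -/
def multiplierRing (m : Ideal R) : Submodule R K := coeSubmodule K m / coeSubmodule K m

variable {K} {m : Ideal R}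

lemma one_le_multiplierRing : 1 ≤ multiplierRing K m := one_le_div_self _

lemma one_mem_multiplierRing : (1 : K) ∈ multiplierRing K m :=
  Submodule.one_le.mp one_le_multiplierRing

lemma algebraMap_mem_multiplierRing (r : R) : algebraMap R K r ∈ multiplierRing K m :=
  algebraMap_mem_of_one_le one_le_multiplierRing r

lemma multiplierRing_mul_self : multiplierRing K m * multiplierRing K m = multiplierRing K m :=
  div_self_mul_div_self _

lemma mul_mem_multiplierRing {x y : K} (hx : x ∈ multiplierRing K m)
    (hy : y ∈ multiplierRing K m) : x * y ∈ multiplierRing K m :=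
  multiplierRing_mul_self.le (Submodule.mul_mem_mul hx hy)

lemma multiplierRing_mul_coeSubmodule :
    multiplierRing K m * coeSubmodule K m = coeSubmodule K m :=
  div_self_mul _

lemma coeSubmodule_le_multiplierRing : coeSubmodule K m ≤ multiplierRing K m :=
  (coeSubmodule_le_one m).trans one_le_multiplierRing

lemma multiplierRing_le : multiplierRing K m ≤ 1 / coeSubmodule K m :=
  div_mono_left _ (coeSubmodule_le_one m)

variable [IsFractionRing R K]

lemma isReduced_of_isSeminormalDomain (hR : IsSeminormalDomain R K) [m.IsPrime] {x : K}
    (hx : x ∈ multiplierRing K m) (h2 : x * x ∈ coeSubmodule K m) : x ∈ coeSubmodule K m := by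
  have hn : ∀ n : ℕ, x ^ (n + 2) ∈ coeSubmodule K m := by
    intro n
    induction n with
    | zero => simpa [pow_two] using h2
    | succ n ih =>
      rw [add_right_comm, pow_succ']
      exact mul_mem_of_mem_div hx ih
  obtain ⟨r, rfl⟩ := hR x ⟨2, fun n hn' => by
    obtain ⟨k, rfl⟩ := Nat.exists_eq_add_of_le' hn'
    obtain ⟨r, -, hr⟩ := (IsLocalization.mem_coeSubmodule K m).mp (hn k)
    exact ⟨r, hr⟩⟩
  rw [← map_mul, algebraMap_mem_coeSubmodule] at h2
  exact algebraMap_mem_coeSubmodule.mpr ((Ideal.IsPrime.mem_or_mem ‹_› h2).elim id id)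

lemma mem_of_algebraMap_mem [hm : m.IsMaximal] {A : Submodule R K} (hmA : coeSubmodule K m ≤ A)
    (hA1 : (1 : K) ∉ A) {r : R} (hr : algebraMap R K r ∈ A) : r ∈ m := by
  by_contra hrm
  obtain ⟨s, c, hc, h⟩ := hm.exists_inv hrm
  apply hA1
  rw [← map_one (algebraMap R K), ← h, map_add, map_mul]
  exact A.add_mem (algebraMap_mul_mem _ _ hr) (hmA (algebraMap_mem_coeSubmodule.mpr hc))

/-- The quotient of the multiplier ring by the maximal ideal `m` has length at most two: an
intermediate ideal is `m` or is maximal. -/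
lemma eq_or_eq_of_wcovBy (hcov : 1 ⩿ multiplierRing K m) [hm : m.IsMaximal]
    {A D : Submodule R K} (hmD : coeSubmodule K m ≤ D) (hDA : D ≤ A)
    (hAE : A ≤ multiplierRing K m) (hA1 : (1 : K) ∉ A) : D = coeSubmodule K m ∨ D = A := by
  have hAR := fun r => mem_of_algebraMap_mem (hmD.trans hDA) hA1 (r := r)
  rcases hcov.eq_or_eq (c := 1 ⊔ D) le_sup_left (sup_le hcov.le (hDA.trans hAE)) with h | h
  · left
    refine le_antisymm (fun x hx => ?_) hmD
    obtain ⟨r, rfl⟩ := Submodule.mem_one.mp ((sup_eq_left.mp h) hx)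
    exact algebraMap_mem_coeSubmodule.mpr (hAR r (hDA hx))
  · right
    refine le_antisymm hDA fun a ha => ?_
    obtain ⟨y, hy, d, hd, rfl⟩ := Submodule.mem_sup.mp (h.ge (hAE ha))
    obtain ⟨r, rfl⟩ := Submodule.mem_one.mp hy
    have hr : algebraMap R K r ∈ A := by simpa using A.sub_mem ha (hDA hd)
    exact D.add_mem (hmD (algebraMap_mem_coeSubmodule.mpr (hAR r hr))) hd

/-- When `E = (m : m)` covers `R` and `E / m` is reduced, every ideal of `E` between `m` and `E`
divides `m`: the ring `E / m` is a reduced algebra of dimension at most two over `R / m`, so each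
of its ideals has a complementary factor. -/
lemma exists_mul_eq_of_wcovBy (hcov : 1 ⩿ multiplierRing K m) [hm : m.IsMaximal]
    (hred : ∀ x ∈ multiplierRing K m, x * x ∈ coeSubmodule K m → x ∈ coeSubmodule K m)
    {A : Submodule R K} (hmA : coeSubmodule K m ≤ A) (hAE : A ≤ multiplierRing K m)
    (hEA : multiplierRing K m * A ≤ A) : ∃ A', A * A' = coeSubmodule K m := by
  by_cases hA1 : (1 : K) ∈ A
  · refine ⟨coeSubmodule K m, le_antisymm ?_ ?_⟩
    · exact (mul_le_mul_left hAE _).trans multiplierRing_mul_coeSubmodule.le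
    · simpa using mul_le_mul_left (Submodule.one_le.mpr hA1) (coeSubmodule K m)
  by_cases hAm : A ≤ 1
  · refine ⟨multiplierRing K m, ?_⟩
    have : A = coeSubmodule K m := by
      refine le_antisymm (fun x hx => ?_) hmA
      obtain ⟨r, rfl⟩ := Submodule.mem_one.mp (hAm hx)
      exact algebraMap_mem_coeSubmodule.mpr (mem_of_algebraMap_mem hmA hA1 hx)
    rw [this, mul_comm, multiplierRing_mul_coeSubmodule]
  obtain ⟨a, haA, ha1⟩ := SetLike.not_le_iff_exists.mp hAm
  have haE := hAE haA
  have hE : 1 ⊔ Submodule.span R {a} = multiplierRing K m := by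
    refine (hcov.eq_or_eq le_sup_left
      (sup_le hcov.le ((Submodule.span_singleton_le_iff_mem _ _).mpr haE))).resolve_left ?_
    intro h
    exact ha1 (sup_eq_left.mp h (Submodule.mem_span_singleton_self a))
  have hrep : ∀ x ∈ multiplierRing K m, ∃ r s : R, x = algebraMap R K s + algebraMap R K r * a := by
    intro x hx
    rw [← hE] at hx
    obtain ⟨y, hy, z, hz, rfl⟩ := Submodule.mem_sup.mp hx
    obtain ⟨s, rfl⟩ := Submodule.mem_one.mp hy
    obtain ⟨r, rfl⟩ := Submodule.mem_span_singleton.mp hz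
    exact ⟨r, s, by rw [Algebra.smul_def]⟩
  have hmE : ∀ {c x : K}, c ∈ coeSubmodule K m → x ∈ multiplierRing K m →
      c * x ∈ coeSubmodule K m := fun {c x} hc hx => by
    rw [mul_comm]; exact mul_mem_of_mem_div hx hc
  -- `a` is a root modulo `m` of a quadratic polynomial `X ^ 2 - r * X` with `r` a unit modulo `m`
  obtain ⟨r, s, hrs⟩ := hrep (a * a) (mul_mem_multiplierRing haE haE)
  have hs : s ∈ m := mem_of_algebraMap_mem hmA hA1 <| by
    have : algebraMap R K s = a * a - algebraMap R K r * a := by rw [hrs]; ring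
    rw [this]
    exact A.sub_mem (hEA (Submodule.mul_mem_mul haE haA)) (algebraMap_mul_mem _ _ haA)
  have hsK := (algebraMap_mem_coeSubmodule (K := K)).mpr hs
  have hr : r ∉ m := by
    intro hr
    refine ha1 (coeSubmodule_le_one m (hred a haE ?_))
    rw [hrs]
    exact Submodule.add_mem _ hsK (hmE (algebraMap_mem_coeSubmodule.mpr hr) haE)
  have hb : a - algebraMap R K r ∈ multiplierRing K m :=
    Submodule.sub_mem _ haE (algebraMap_mem_multiplierRing r)
  refine ⟨coeSubmodule K m ⊔ Submodule.span R {a - algebraMap R K r}, le_antisymm ?_ ?_⟩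
  · rw [Submodule.mul_le]
    intro x hx y hy
    obtain ⟨c, hc, z, hz, rfl⟩ := Submodule.mem_sup.mp hy
    obtain ⟨t, rfl⟩ := Submodule.mem_span_singleton.mp hz
    rw [Algebra.smul_def, mul_add]
    refine Submodule.add_mem _ (by rw [mul_comm]; exact hmE hc (hAE hx)) ?_
    obtain ⟨v, u, huv⟩ := hrep x (hAE hx)
    have hu : u ∈ m := mem_of_algebraMap_mem hmA hA1 <| by
      have : algebraMap R K u = x - algebraMap R K v * a := by rw [huv]; ring
      rw [this]
      exact A.sub_mem hx (algebraMap_mul_mem _ _ haA)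
    have : x * (algebraMap R K t * (a - algebraMap R K r)) =
        algebraMap R K t * (algebraMap R K u * (a - algebraMap R K r)
          + algebraMap R K v * algebraMap R K s) := by
      rw [huv]
      linear_combination (algebraMap R K t * algebraMap R K v) * hrs
    rw [this]
    exact algebraMap_mul_mem _ _ (Submodule.add_mem _
      (hmE (algebraMap_mem_coeSubmodule.mpr hu) hb) (algebraMap_mul_mem _ _ hsK))
  · -- `r * c = c * a - c * (a - r)` for `c ∈ m`, and `r` is invertible modulo `m`
    set A' := coeSubmodule K m ⊔ Submodule.span R {a - algebraMap R K r}
    have hmA' : coeSubmodule K m ≤ A' := le_sup_left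
    have hbA' : a - algebraMap R K r ∈ A' := le_sup_right (a := coeSubmodule K m)
      (Submodule.mem_span_singleton_self _)
    intro c hc
    have h1 : algebraMap R K r * c ∈ A * A' := by
      have : algebraMap R K r * c = a * c - c * (a - algebraMap R K r) := by ring
      rw [this]
      exact Submodule.sub_mem _ (Submodule.mul_mem_mul haA (hmA' hc))
        (Submodule.mul_mem_mul (hmA hc) hbA')
    obtain ⟨q, d, hd, h⟩ := hm.exists_inv hr
    have : c = algebraMap R K q * (algebraMap R K r * c) + algebraMap R K d * c := by
      rw [← mul_assoc, ← add_mul, ← map_mul, ← map_add, h, map_one, one_mul]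
    rw [this]
    exact Submodule.add_mem _ (algebraMap_mul_mem _ _ h1)
      (Submodule.mul_mem_mul (hmA (algebraMap_mem_coeSubmodule.mpr hd)) (hmA' hc))

end Multiplier

/-! ### Local generators of ideals -/

section LocalGenerators

variable {R K : Type*} [CommRing R] [Field K] [Algebra R K]

variable (K) in
/-- The local condition at a maximal ideal `m` by which all three properties are compared: with
`E = (m : m)`, the ideal `m` is invertible in `E`, and there is no `R`-module strictly between
`R` and `E`. -/
structure IsStableQuadratic (m : Ideal R) : Prop where
  invertible : coeSubmodule K m * (multiplierRing K m / coeSubmodule K m) = multiplierRing K m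
  wcovBy : 1 ⩿ multiplierRing K m

lemma exists_eq_sup_span_of_wcovBy {E : Submodule R K} (h : 1 ⩿ E) :
    ∃ y ∈ E, E = 1 ⊔ Submodule.span R {y} := by
  by_cases hE : E ≤ 1
  · refine ⟨0, E.zero_mem, ?_⟩
    rw [Submodule.span_zero_singleton, sup_bot_eq]
    exact le_antisymm hE h.le
  · obtain ⟨y, hy, hy1⟩ := SetLike.not_le_iff_exists.mp hE
    refine ⟨y, hy, ((h.eq_or_eq le_sup_left (sup_le h.le
      ((Submodule.span_singleton_le_iff_mem _ _).mpr hy))).resolve_left fun h' => hy1 ?_).symm⟩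
    exact sup_eq_left.mp h' (Submodule.mem_span_singleton_self y)

lemma fg_of_mul_mem_one [IsNoetherianRing R] {N : Submodule R K} {d : K} (hd : d ≠ 0)
    (h : ∀ x ∈ N, d * x ∈ (1 : Submodule R K)) : N.FG := by
  have hle : N ≤ Submodule.span R {d⁻¹} := by
    intro x hx
    obtain ⟨r, hr⟩ := Submodule.mem_one.mp (h x hx)
    refine Submodule.mem_span_singleton.mpr ⟨r, ?_⟩
    rw [Algebra.smul_def, hr]
    field_simp
  have : IsNoetherian R (Submodule.span R {d⁻¹}) :=
    isNoetherian_span_of_finite R (Set.finite_singleton _)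
  have := isNoetherian_of_le hle
  exact (Submodule.fg_top N).mp (IsNoetherian.noetherian _)

variable [IsFractionRing R K] {m : Ideal R}

lemma fg_of_le_multiplierRing [IsNoetherianRing R] (hm0 : m ≠ ⊥) {N : Submodule R K}
    (hN : N ≤ multiplierRing K m) : N.FG := by
  obtain ⟨c, hc, hc0⟩ := (Submodule.ne_bot_iff _).mp (coeSubmodule_ne_bot (K := K) hm0)
  refine fg_of_mul_mem_one hc0 fun x hx => coeSubmodule_le_one m ?_
  rw [mul_comm]
  exact mul_mem_of_mem_div (hN hx) hc

/-- Ideals of `E = (m : m)` are invertible locally at `m`. By Noetherian induction: an ideal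
`L` of `E` with `L + m ≠ E` is contained in the invertible ideal `A = L + m`, and the larger ideal
`A⁻¹ L` may replace it. -/
lemma exists_algebraMap_mem_mul_div [IsNoetherianRing R] [hm : m.IsMaximal] (hm0 : m ≠ ⊥)
    (h : IsStableQuadratic K m)
    (hred : ∀ x ∈ multiplierRing K m, x * x ∈ coeSubmodule K m → x ∈ coeSubmodule K m)
    (L : Submodule R K) (hL0 : L ≠ ⊥) (hLE : L ≤ multiplierRing K m)
    (hEL : multiplierRing K m * L ≤ L) :
    ∃ s ∉ m, algebraMap R K s ∈ L * (multiplierRing K m / L) := by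
  set E := multiplierRing K m with hEdef
  have hnoeth : IsNoetherian R E := isNoetherian_of_fg_of_noetherian E
    (fg_of_le_multiplierRing hm0 le_rfl)
  have hwf : WellFoundedGT (Set.Iic E) :=
    (Submodule.mapIic E).symm.toOrderEmbedding.wellFoundedGT
  obtain ⟨L', hL'⟩ : ∃ L' : Set.Iic E, (L' : Submodule R K) = L := ⟨⟨L, hLE⟩, rfl⟩
  induction L' using hwf.induction generalizing L with
  | _ L' ih =>
  subst hL'
  obtain ⟨L, hLE'⟩ := L'
  simp only at *
  have hEA : E * (L ⊔ coeSubmodule K m) ≤ L ⊔ coeSubmodule K m := by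
    rw [Submodule.mul_sup]
    exact sup_le_sup hEL multiplierRing_mul_coeSubmodule.le
  have hAE : L ⊔ coeSubmodule K m ≤ E := sup_le hLE coeSubmodule_le_multiplierRing
  by_cases hA1 : (1 : K) ∈ L ⊔ coeSubmodule K m
  · obtain ⟨l, hl, c, hcK, hlc⟩ := Submodule.mem_sup.mp hA1
    obtain ⟨c, hc, rfl⟩ := (IsLocalization.mem_coeSubmodule K m).mp hcK
    refine ⟨1 - c, fun h' => ?_, ?_⟩
    · exact hm.ne_top ((Ideal.eq_top_iff_one _).mpr (by simpa using m.add_mem h' hc))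
    · have hl' : algebraMap R K (1 - c) = l * 1 := by
        rw [map_sub, map_one]
        linear_combination (-1 : K) * hlc
      rw [hl']
      exact Submodule.mul_mem_mul hl (Submodule.one_mem_div.mpr hLE)
  obtain ⟨A', hAA'⟩ := exists_mul_eq_of_wcovBy h.wcovBy hred le_sup_right hAE hEA
  set A := L ⊔ coeSubmodule K m
  set B := A' * (E / coeSubmodule K m)
  have hAB : A * B = E := by rw [← mul_assoc, hAA']; exact h.invertible
  have hEB : E * (B * L) ≤ B * L := by
    rw [mul_left_comm]
    exact mul_le_mul_right hEL B
  have hLA : L ≤ A * (B * L) := by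
    rw [← mul_assoc, hAB]
    simpa using mul_le_mul_left (one_le_multiplierRing (K := K) (m := m)) L
  have hle : L ≤ B * L := hLA.trans ((mul_le_mul_left hAE _).trans hEB)
  have hB : B * L ≤ E := by
    rw [← hAB, mul_comm A]
    exact mul_le_mul_right le_sup_left B
  have hlt : L < B * L := by
    refine lt_of_le_of_ne hle fun heq => hA1 ?_
    rw [← heq] at hLA
    exact one_mem_of_le_mul one_le_multiplierRing multiplierRing_mul_self.le hAE hEA
      (fg_of_le_multiplierRing hm0 hLE) hL0 hLA
  obtain ⟨s, hs, hs'⟩ := ih ⟨B * L, hB⟩ hlt (B * L) (ne_bot_of_gt hlt) hB hEB rfl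
  refine ⟨s, hs, ?_⟩
  have : B * (E / (B * L)) ≤ E / L := by
    rw [Submodule.le_div_iff_mul_le]
    calc B * (E / (B * L)) * L = E / (B * L) * (B * L) := by ring
      _ ≤ E := div_mul_le _ _
  have h2 : B * L * (E / (B * L)) = L * (B * (E / (B * L))) := by ring
  rw [h2] at hs'
  exact mul_le_mul_right this L hs'

/-- If a product `I * W` of modules meets `R` outside `m`, then so does `x * W` for a single
`x ∈ I`. The ring `E / m` has at most two maximal ideals, and an additive group is not the union
of two proper subgroups. -/
lemma exists_mul_eq_algebraMap_of_mem_mul [hm : m.IsMaximal] (hcov : 1 ⩿ multiplierRing K m)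
    {I W : Submodule R K} (hW : multiplierRing K m * W ≤ W) (hIW : I * W ≤ multiplierRing K m)
    {s : R} (hs : s ∉ m) (hsIW : algebraMap R K s ∈ I * W) :
    ∃ x ∈ I, ∃ w ∈ W, ∃ t ∉ m, x * w = algebraMap R K t := by
  set E := multiplierRing K m with hEdef
  let A : K → Submodule R K := fun x => Submodule.span R {x} * W ⊔ coeSubmodule K m
  have hmul : ∀ x, ∀ w ∈ W, x * w ∈ A x := fun x w hw => Submodule.mem_sup_left
    (Submodule.mul_mem_mul (Submodule.mem_span_singleton_self x) hw)
  have hmA : ∀ x, coeSubmodule K m ≤ A x := fun x => le_sup_right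
  have hAle : ∀ {x B}, coeSubmodule K m ≤ B → (∀ w ∈ W, x * w ∈ B) → A x ≤ B := by
    intro x B hB h
    refine sup_le (fun y hy => ?_) hB
    obtain ⟨w, hw, rfl⟩ := mem_span_singleton_mul_iff.mp hy
    exact h w hw
  have hAE : ∀ x ∈ I, A x ≤ E := fun x hx => hAle coeSubmodule_le_multiplierRing
    fun w hw => hIW (Submodule.mul_mem_mul hx hw)
  have hEA : ∀ x, E * A x ≤ A x := by
    intro x
    rw [Submodule.mul_sup, mul_left_comm]
    exact sup_le_sup (mul_le_mul_right hW _) multiplierRing_mul_coeSubmodule.le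
  by_cases hex : ∃ x ∈ I, (1 : K) ∈ A x
  · obtain ⟨x, hx, h1⟩ := hex
    obtain ⟨y, hy, c, hcK, hyc⟩ := Submodule.mem_sup.mp h1
    obtain ⟨w, hw, rfl⟩ := mem_span_singleton_mul_iff.mp hy
    obtain ⟨c, hc, rfl⟩ := (IsLocalization.mem_coeSubmodule K m).mp hcK
    refine ⟨x, hx, w, hw, 1 - c, fun h' => ?_, ?_⟩
    · exact hm.ne_top ((Ideal.eq_top_iff_one _).mpr (by simpa using m.add_mem h' hc))
    · rw [map_sub, map_one, ← hyc]; ring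
  push Not at hex
  exfalso
  obtain ⟨u, hu, hum⟩ : ∃ u ∈ I, ¬ A u ≤ coeSubmodule K m := by
    by_contra! hcon
    have : I * W ≤ coeSubmodule K m :=
      Submodule.mul_le.mpr fun x hx w hw => hcon x hx (hmul x w hw)
    exact hs (algebraMap_mem_coeSubmodule.mp (this hsIW))
  obtain ⟨v, hv, hvu⟩ : ∃ v ∈ I, ¬ A v ≤ A u := by
    by_contra! hcon
    have : I * W ≤ A u := Submodule.mul_le.mpr fun x hx w hw => hcon x hx (hmul x w hw)
    exact hs (mem_of_algebraMap_mem (hmA u) (hex u hu) (this hsIW))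
  have huv := I.add_mem hu hv
  have h1 : A u ⊓ A v = coeSubmodule K m :=
    (eq_or_eq_of_wcovBy hcov (le_inf (hmA u) (hmA v)) inf_le_right (hAE v hv)
      (hex v hv)).resolve_right fun h => hvu (inf_eq_right.mp h)
  have h2 : ¬ A (u + v) ≤ A u := fun h => hvu <| hAle (hmA u) fun w hw => by
    have : v * w = (u + v) * w - u * w := by ring
    rw [this]
    exact Submodule.sub_mem _ (h (hmul _ w hw)) (hmul u w hw)
  have h3 : ¬ A (u + v) ≤ A v := fun h => hum <| by
    rw [← h1]
    refine le_inf le_rfl (hAle (hmA v) fun w hw => ?_)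
    have : u * w = (u + v) * w - v * w := by ring
    rw [this]
    exact Submodule.sub_mem _ (h (hmul _ w hw)) (hmul v w hw)
  have hsup : ∀ x ∈ I, ¬ A x ≤ coeSubmodule K m → ¬ A (u + v) ≤ A x →
      (1 : K) ∈ A x ⊔ A (u + v) := by
    intro x hx hxm hux
    by_contra hcon
    rcases eq_or_eq_of_wcovBy hcov (hmA x) (le_sup_left (b := A (u + v)))
      (sup_le (hAE x hx) (hAE _ huv)) hcon with h | h
    · exact hxm h.le
    · exact hux (sup_eq_left.mp h.symm)
  have hvm : ¬ A v ≤ coeSubmodule K m := fun h => hvu (h.trans (hmA u))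
  obtain ⟨p, hp, q, hq, hpq⟩ := Submodule.mem_sup.mp (hsup u hu hum h2)
  obtain ⟨p', hp', q', hq', hpq'⟩ := Submodule.mem_sup.mp (hsup v hv hvm h3)
  have hpp : p * p' ∈ A (u + v) := by
    apply hmA
    rw [← h1]
    refine ⟨?_, ?_⟩
    · rw [mul_comm]; exact hEA u (Submodule.mul_mem_mul (hAE v hv hp') hp)
    · exact hEA v (Submodule.mul_mem_mul (hAE u hu hp) hp')
  have : (1 : K) = p * p' + (p * q' + q * 1) := by
    linear_combination (-1 : K) * hpq - p * hpq'
  apply hex _ huv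
  rw [this]
  refine Submodule.add_mem _ hpp (Submodule.add_mem _ ?_ (by simpa using hq))
  exact hEA _ (Submodule.mul_mem_mul (hAE u hu hp) hq')

/-- Locally at `m`, every nonzero ideal of `R` is isomorphic to `R` or to `E = (m : m)`. -/
lemma exists_local_generator [IsNoetherianRing R] [hm : m.IsMaximal] (hm0 : m ≠ ⊥)
    (h : IsStableQuadratic K m)
    (hred : ∀ x ∈ multiplierRing K m, x * x ∈ coeSubmodule K m → x ∈ coeSubmodule K m)
    {I : Ideal R} (hI : I ≠ ⊥) :
    ∃ x ∈ I, x ≠ 0 ∧ ∃ t ∉ m, (∀ i ∈ I, ∃ r, t * i = r * x) ∨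
      ((∀ i ∈ I, ∃ e ∈ multiplierRing K m, algebraMap R K (t * i) = e * algebraMap R K x) ∧
        ∀ e ∈ multiplierRing K m, e * algebraMap R K x ∈ coeSubmodule K I) := by
  set E := multiplierRing K m with hEdef
  have hW : E * (E / coeSubmodule K I) ≤ E / coeSubmodule K I := by
    rw [Submodule.le_div_iff_mul_le, mul_assoc]
    exact (mul_le_mul_right (div_mul_le _ _) E).trans multiplierRing_mul_self.le
  have hE1 : (1 : Submodule R K) ≤ E := one_le_multiplierRing
  have hEI : coeSubmodule K I ≤ E * coeSubmodule K I := by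
    simpa using mul_le_mul_left hE1 (coeSubmodule K I)
  have hL0 : E * coeSubmodule K I ≠ ⊥ := fun h0 => coeSubmodule_ne_bot hI
    (le_bot_iff.mp (hEI.trans h0.le))
  have hLE : E * coeSubmodule K I ≤ E := by
    simpa using mul_le_mul_right (coeSubmodule_le_one I) E
  obtain ⟨s, hs, hs'⟩ := exists_algebraMap_mem_mul_div hm0 h hred (E * coeSubmodule K I) hL0 hLE
    (by rw [← mul_assoc, multiplierRing_mul_self])
  have hle : E * coeSubmodule K I * (E / (E * coeSubmodule K I)) ≤
      coeSubmodule K I * (E / coeSubmodule K I) := by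
    rw [mul_comm E (coeSubmodule K I), mul_assoc, mul_comm (coeSubmodule K I) E]
    refine mul_le_mul_right ?_ _
    exact (mul_le_mul_right (div_anti E hEI) E).trans hW
  obtain ⟨y, hy, w, hw, t, ht, hyw⟩ := exists_mul_eq_algebraMap_of_mem_mul h.wcovBy hW
    (by rw [mul_comm]; exact div_mul_le _ _) hs (hle hs')
  obtain ⟨x, hx, rfl⟩ := (IsLocalization.mem_coeSubmodule K I).mp hy
  have hi : ∀ i ∈ I, w * algebraMap R K i ∈ E ∧
      algebraMap R K (t * i) = w * algebraMap R K i * algebraMap R K x := fun i hi => by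
    refine ⟨mul_mem_of_mem_div hw (algebraMap_mem_coeSubmodule.mpr hi), ?_⟩
    rw [map_mul, ← hyw]; ring
  refine ⟨x, hx, ?_, t, ht, ?_⟩
  · rintro rfl
    rw [map_zero, zero_mul, eq_comm, IsFractionRing.to_map_eq_zero_iff] at hyw
    exact ht (hyw ▸ m.zero_mem)
  have hB1 : (1 : K) ∈ coeSubmodule K I / Submodule.span R {algebraMap R K x} := by
    rwa [Submodule.one_mem_div, Submodule.span_singleton_le_iff_mem]
  rcases h.wcovBy.eq_or_eq (c := E ⊓ coeSubmodule K I / Submodule.span R {algebraMap R K x})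
    (le_inf hE1 (Submodule.one_le.mpr hB1)) inf_le_left with hB | hB
  · left
    intro i hiI
    have hmem : w * algebraMap R K i ∈
        E ⊓ coeSubmodule K I / Submodule.span R {algebraMap R K x} := by
      refine ⟨(hi i hiI).1, fun z hz => ?_⟩
      obtain ⟨r, rfl⟩ := Submodule.mem_span_singleton.mp hz
      rw [Algebra.smul_def, mul_left_comm, ← (hi i hiI).2]
      exact algebraMap_mul_mem _ _ (algebraMap_mem_coeSubmodule.mpr (I.mul_mem_left t hiI))
    rw [hB] at hmem
    obtain ⟨r, hr⟩ := Submodule.mem_one.mp hmem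
    refine ⟨r, IsFractionRing.injective R K ?_⟩
    rw [(hi i hiI).2, ← hr, map_mul]
  · right
    refine ⟨fun i hiI => ⟨_, (hi i hiI).1, (hi i hiI).2⟩, fun e he => ?_⟩
    exact (inf_eq_left.mp hB) he _ (Submodule.mem_span_singleton_self _)

end LocalGenerators

/-! ### Stability and two-generation -/

section Consequences

variable {R K : Type*} [CommRing R] [Field K] [Algebra R K] [IsFractionRing R K]

lemma isStableIdeal_of_isStableQuadratic [IsNoetherianRing R] (hR : IsSeminormalDomain R K)
    (h : ∀ m : Ideal R, m.IsMaximal → m ≠ ⊥ → IsStableQuadratic K m) {I : Ideal R}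
    (hI : I ≠ ⊥) : IsStableIdeal K I := by
  set N := coeSubmodule K I
  set F := N / N with hF
  have hFF : F * (F / N) ≤ F / N := by
    rw [Submodule.le_div_iff_mul_le, mul_assoc]
    exact (mul_le_mul_right (div_mul_le _ _) F).trans (div_self_mul_div_self N).le
  refine le_antisymm (by rw [mul_comm]; exact div_mul_le _ _) ?_
  suffices h1 : (1 : K) ∈ N * (F / N) by
    calc F = F * 1 := (mul_one F).symm
      _ ≤ F * (N * (F / N)) := mul_le_mul_right (Submodule.one_le.mpr h1) F
      _ = N * (F * (F / N)) := by ring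
      _ ≤ N * (F / N) := mul_le_mul_right hFF N
  -- the ideal `N * (F : N) ∩ R` is contained in no maximal ideal
  suffices htop : (N * (F / N)).comap (Algebra.linearMap R K) = ⊤ by
    have : (1 : R) ∈ (N * (F / N)).comap (Algebra.linearMap R K) := htop ▸ Submodule.mem_top
    simpa using this
  by_contra hne
  obtain ⟨m, hm, hle⟩ := Ideal.exists_le_maximal _ hne
  replace hle : ∀ t : R, algebraMap R K t ∈ N * (F / N) → t ∈ m := fun t ht => hle ht
  by_cases hm0 : m = ⊥
  · obtain ⟨i, hi, hi0⟩ := I.ne_bot_iff.mp hI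
    have hi' : algebraMap R K i ∈ N * (F / N) := by
      rw [← mul_one (algebraMap R K i)]
      refine Submodule.mul_mem_mul (algebraMap_mem_coeSubmodule.mpr hi) ?_
      exact Submodule.one_mem_div.mpr ((coeSubmodule_le_one I).trans (one_le_div_self N))
    have := hle i hi'
    rw [hm0] at this
    exact hi0 this
  obtain ⟨x, hxI, hx0, t, ht, hx⟩ := exists_local_generator hm0 (h m hm hm0)
    (fun y hy hy2 => isReduced_of_isSeminormalDomain hR hy hy2) hI
  have hxN : algebraMap R K x ∈ N := algebraMap_mem_coeSubmodule.mpr hxI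
  have hx0K : algebraMap R K x ≠ 0 := fun h0 =>
    hx0 ((IsFractionRing.to_map_eq_zero_iff (K := K)).mp h0)
  rcases hx with hx | ⟨hx, hxE⟩
  · refine ht (hle t ?_)
    have : algebraMap R K t = algebraMap R K x * (algebraMap R K t / algebraMap R K x) := by
      field_simp
    rw [this]
    refine Submodule.mul_mem_mul hxN fun y hy => ?_
    obtain ⟨i, hi, rfl⟩ := (IsLocalization.mem_coeSubmodule K I).mp hy
    obtain ⟨r, hr⟩ := hx i hi
    rw [div_mul_eq_mul_div, ← map_mul, hr, map_mul, mul_div_cancel_right₀ _ hx0K]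
    exact algebraMap_mem_of_one_le (one_le_div_self N) r
  · have htt : t * t ∉ m := fun h' => (hm.isPrime.mem_or_mem h').elim ht ht
    refine htt (hle _ ?_)
    have : algebraMap R K (t * t) =
        algebraMap R K x * (algebraMap R K (t * t) / algebraMap R K x) := by
      field_simp
    rw [this]
    refine Submodule.mul_mem_mul hxN fun y hy => ?_
    obtain ⟨i, hi, rfl⟩ := (IsLocalization.mem_coeSubmodule K I).mp hy
    obtain ⟨e, he, hie⟩ := hx i hi
    have : algebraMap R K (t * t) / algebraMap R K x * algebraMap R K i = algebraMap R K t * e := by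
      rw [map_mul] at hie ⊢
      field_simp
      linear_combination algebraMap R K t * hie
    rw [this]
    intro y hy
    obtain ⟨j, hj, rfl⟩ := (IsLocalization.mem_coeSubmodule K I).mp hy
    obtain ⟨e', he', hje⟩ := hx j hj
    have : algebraMap R K t * e * algebraMap R K j = e * e' * algebraMap R K x := by
      rw [map_mul] at hje
      linear_combination e * hje
    rw [this]
    exact hxE _ (mul_mem_multiplierRing he he')

lemma exists_le_span_pair_sup_smul [IsNoetherianRing R] (hR : IsSeminormalDomain R K) {m : Ideal R}
    [hm : m.IsMaximal] (hm0 : m ≠ ⊥) (h : IsStableQuadratic K m) {I : Ideal R} (hI : I ≠ ⊥) :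
    ∃ x ∈ I, ∃ u ∈ I, I ≤ Ideal.span {x, u} ⊔ m • I := by
  obtain ⟨x, hxI, hx0, t, ht, hx⟩ := exists_local_generator hm0 h
    (fun y hy hy2 => isReduced_of_isSeminormalDomain hR hy hy2) hI
  suffices hu : ∃ u ∈ I, ∀ i ∈ I, t * i ∈ Ideal.span {x, u} by
    obtain ⟨u, hu, hui⟩ := hu
    refine ⟨x, hxI, u, hu, fun i hi => ?_⟩
    obtain ⟨q, c, hc, hqc⟩ := hm.exists_inv ht
    have : i = q * (t * i) + c • i := by
      rw [smul_eq_mul]; linear_combination (-i) * hqc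
    rw [this]
    exact Submodule.add_mem_sup (Ideal.mul_mem_left _ _ (hui i hi))
      (Submodule.smul_mem_smul hc hi)
  rcases hx with hx | ⟨hx, hxE⟩
  · refine ⟨x, hxI, fun i hi => ?_⟩
    obtain ⟨r, hr⟩ := hx i hi
    rw [hr]
    exact Ideal.mul_mem_left _ _ (Ideal.subset_span (by simp))
  · obtain ⟨y, hy, hyE⟩ := exists_eq_sup_span_of_wcovBy h.wcovBy
    obtain ⟨u, hu, hux⟩ := (IsLocalization.mem_coeSubmodule K I).mp (hxE y hy)
    refine ⟨u, hu, fun i hi => ?_⟩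
    obtain ⟨e, he, hie⟩ := hx i hi
    rw [hyE] at he
    obtain ⟨z, hz, w, hw, rfl⟩ := Submodule.mem_sup.mp he
    obtain ⟨p, rfl⟩ := Submodule.mem_one.mp hz
    obtain ⟨q, rfl⟩ := Submodule.mem_span_singleton.mp hw
    refine Ideal.mem_span_pair.mpr ⟨p, q, IsFractionRing.injective R K ?_⟩
    rw [hie, map_add, map_mul, map_mul, hux, Algebra.smul_def]
    ring

end Consequences

section TwoGenerated

variable {R : Type*} [CommRing R]

/-- Simultaneous choice in an ideal: if `N m < I` and `m • I ≤ N m` for finitely many maximal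
ideals `m`, some element of `I` avoids all the `N m`. -/
lemma exists_mem_forall_notMem (S : Set (Ideal R)) (hS : S.Finite) (hmax : ∀ m ∈ S, m.IsMaximal)
    (I : Ideal R) (N : Ideal R → Ideal R) (hle : ∀ m ∈ S, m • I ≤ N m)
    (hlt : ∀ m ∈ S, ¬ I ≤ N m) : ∃ x ∈ I, ∀ m ∈ S, x ∉ N m := by
  classical
  have := hS.to_subtype
  have := Fintype.ofFinite S
  have hx : ∀ m : S, ∃ x ∈ I, x ∉ N m := fun m => SetLike.not_le_iff_exists.mp (hlt m m.2)
  choose x hxI hxN using hx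
  have hr : ∀ m : S, ∃ r : R, ∀ m' : S, r - (if m' = m then 1 else 0) ∈ (m' : Ideal R) := by
    intro m
    refine Ideal.exists_forall_sub_mem_ideal (I := fun m' : S => (m' : Ideal R)) ?_ _
    intro m₁ m₂ hne
    have := hmax m₁ m₁.2
    have := hmax m₂ m₂.2
    exact Ideal.isCoprime_of_isMaximal (fun h => hne (Subtype.ext h))
  choose r hr using hr
  refine ⟨∑ m, r m * x m, I.sum_mem fun m _ => I.mul_mem_left _ (hxI m), fun m hm hmem => ?_⟩
  apply hxN ⟨m, hm⟩
  have h1 : x ⟨m, hm⟩ = (∑ m', r m' * x m') -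
      ∑ m', (r m' - (if (⟨m, hm⟩ : S) = m' then 1 else 0)) * x m' := by
    simp [sub_mul, Finset.sum_sub_distrib]
  rw [h1]
  refine (N m).sub_mem hmem ((N m).sum_mem fun m' _ => hle m hm ?_)
  exact Submodule.smul_mem_smul (hr m' ⟨m, hm⟩) (hxI m')

lemma eq_of_forall_le_sup_smul {I J : Ideal R} (hI : I.FG) (hJ : J ≤ I)
    (h : ∀ m : Ideal R, m.IsMaximal → I ≤ J ⊔ m • I) : I = J := by
  refine le_antisymm ?_ hJ
  have htop : J.colon (I : Set R) = ⊤ := by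
    by_contra hne
    obtain ⟨m, hm, hle⟩ := Ideal.exists_le_maximal _ hne
    obtain ⟨r, hr, hrI⟩ := Submodule.exists_sub_one_mem_and_smul_le_of_fg_of_le_sup hI le_rfl
      (h m hm)
    have hrm : r ∈ m := hle (Submodule.mem_colon.mpr fun i hi =>
      hrI (Submodule.smul_mem_pointwise_smul i r I hi))
    exact hm.ne_top ((Ideal.eq_top_iff_one _).mpr (by simpa using m.sub_mem hrm hr))
  intro i hi
  have h1 : (1 : R) ∈ J.colon (I : Set R) := htop ▸ Submodule.mem_top
  simpa using Submodule.mem_colon.mp h1 i hi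

lemma finite_setOf_isMaximal_mem [IsNoetherianRing R] [Ring.DimensionLEOne R] [IsDomain R]
    {a : R} (ha : a ≠ 0) :
    {m : Ideal R | m.IsMaximal ∧ a ∈ m}.Finite := by
  refine (Ideal.finite_minimalPrimes_of_isNoetherianRing R (Ideal.span {a})).subset ?_
  rintro m ⟨hm, ham⟩
  refine ⟨⟨hm.isPrime, (Ideal.span_singleton_le_iff_mem _).mpr ham⟩, fun q ⟨hq, haq⟩ hqm => ?_⟩
  have haq' := (Ideal.span_singleton_le_iff_mem _).mp haq
  have hq0 : q ≠ ⊥ := fun h0 => ha (by simpa [h0] using haq')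
  exact ((hq.isMaximal hq0).eq_of_le hm.ne_top hqm).ge

/-- Steinitz exchange in the vector space `I / m I`. -/
lemma mem_sup_span_of_mem_sup_span {m I N : Ideal R} [hm : m.IsMaximal] {v w : R} (hv : v ∈ I)
    (hw : w ∉ N ⊔ m • I) (h : w ∈ N ⊔ Ideal.span {v} ⊔ m • I) :
    v ∈ N ⊔ Ideal.span {w} ⊔ m • I := by
  obtain ⟨y, hy, c, hc, hyc⟩ := Submodule.mem_sup.mp h
  obtain ⟨n, hn, z, hz, rfl⟩ := Submodule.mem_sup.mp hy
  obtain ⟨q, rfl⟩ := Ideal.mem_span_singleton'.mp hz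
  have hq : q ∉ m := fun hq => hw <| by
    rw [← hyc, add_assoc]
    exact Submodule.add_mem_sup hn (Submodule.add_mem _ (Submodule.smul_mem_smul hq hv) hc)
  obtain ⟨p, d, hd, hpd⟩ := hm.exists_inv hq
  have : v = (-p * n + p * w) + (d • v - p * c) := by
    rw [smul_eq_mul]; linear_combination (-v) * hpd + p * hyc
  rw [this]
  refine Submodule.add_mem_sup (Submodule.add_mem_sup (Ideal.mul_mem_left _ _ hn)
    (Ideal.mul_mem_left _ _ (Ideal.mem_span_singleton_self _))) (Submodule.sub_mem _
    (Submodule.smul_mem_smul hd hv) (Ideal.mul_mem_left _ _ hc))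

/-- Two elements that are independent in `I / m I` generate it if two elements do. -/
lemma le_span_sup_span_of_le_span_pair {m I : Ideal R} [hm : m.IsMaximal] {x u a b : R}
    (hx : x ∈ I) (hu : u ∈ I) (hxu : I ≤ Ideal.span {x, u} ⊔ m • I) (haI : a ∈ I)
    (ha : a ∉ m • I) (hbI : b ∈ I) (hb : b ∉ Ideal.span {a} ⊔ m • I) :
    I ≤ Ideal.span {a} ⊔ Ideal.span {b} ⊔ m • I := by
  rw [Ideal.span_insert] at hxu
  have key : ∀ v ∈ I, I ≤ Ideal.span {a} ⊔ Ideal.span {v} ⊔ m • I →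
      I ≤ Ideal.span {a} ⊔ Ideal.span {b} ⊔ m • I := by
    intro v hv hle
    refine hle.trans (sup_le (sup_le (le_sup_left.trans le_sup_left) ?_) le_sup_right)
    rw [Ideal.span_singleton_le_iff_mem]
    exact mem_sup_span_of_mem_sup_span hv hb (hle hbI)
  by_cases hax : a ∈ Ideal.span {x} ⊔ m • I
  · refine key u hu (hxu.trans (sup_le (sup_le ?_ (le_sup_right.trans le_sup_left)) le_sup_right))
    rw [Ideal.span_singleton_le_iff_mem]
    have := mem_sup_span_of_mem_sup_span (N := ⊥) hx (by simpa using ha) (by simpa using hax)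
    rw [bot_sup_eq] at this
    have hle : Ideal.span {a} ⊔ m • I ≤ Ideal.span {a} ⊔ Ideal.span {u} ⊔ m • I :=
      sup_le_sup_right le_sup_left _
    exact hle this
  · refine key x hx (hxu.trans (sup_le (sup_le (le_sup_right.trans le_sup_left) ?_) le_sup_right))
    rw [Ideal.span_singleton_le_iff_mem, sup_comm (Ideal.span {a})]
    exact mem_sup_span_of_mem_sup_span hu hax (hxu haI)

/-- An ideal of a one-dimensional Noetherian domain that is generated by two elements modulo
`m I` for every maximal ideal `m` is generated by two elements. -/
lemma isTwoGenerated_of_forall_isMaximal [IsNoetherianRing R] [Ring.DimensionLEOne R] [IsDomain R]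
    {I : Ideal R} (hI : I ≠ ⊥)
    (h : ∀ m : Ideal R, m.IsMaximal → ∃ x ∈ I, ∃ u ∈ I, I ≤ Ideal.span {x, u} ⊔ m • I) :
    IsTwoGenerated I := by
  obtain ⟨d, hd, hd0⟩ := I.ne_bot_iff.mp hI
  have hfg : I.FG := IsNoetherian.noetherian I
  have hnak : ∀ m : Ideal R, m.IsMaximal → ¬ I ≤ m • I := by
    intro m hm hle
    obtain ⟨r, hr, hr0⟩ :=
      Submodule.exists_sub_one_mem_and_smul_eq_zero_of_fg_of_le_smul m I hfg hle
    have : r = 0 := (mul_eq_zero.mp (hr0 d hd)).resolve_right hd0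
    rw [this, zero_sub] at hr
    exact hm.ne_top ((Ideal.eq_top_iff_one _).mpr (by simpa using m.neg_mem hr))
  -- `a` is part of a minimal generating set of `I` locally at the maximal ideals above `I`
  obtain ⟨a, haI, ha0, ha⟩ : ∃ a ∈ I, a ≠ 0 ∧ ∀ m : Ideal R, m.IsMaximal → I ≤ m → a ∉ m • I := by
    by_cases hI1 : I = ⊤
    · exact ⟨d, hd, hd0, fun m hm hIm => absurd (top_le_iff.mp (hI1 ▸ hIm)) hm.ne_top⟩
    obtain ⟨a, haI, ha⟩ := exists_mem_forall_notMem {m : Ideal R | m.IsMaximal ∧ I ≤ m}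
      ((finite_setOf_isMaximal_mem hd0).subset fun m hm => ⟨hm.1, hm.2 hd⟩) (fun m hm => hm.1)
      I (fun m => m • I) (fun m _ => le_rfl) (fun m hm => hnak m hm.1)
    obtain ⟨m, hm, hIm⟩ := Ideal.exists_le_maximal I hI1
    refine ⟨a, haI, fun h0 => ha m ⟨hm, hIm⟩ (h0 ▸ Submodule.zero_mem _), fun m hm hIm =>
      ha m ⟨hm, hIm⟩⟩
  obtain ⟨b, hbI, hb⟩ := exists_mem_forall_notMem
    {m : Ideal R | (m.IsMaximal ∧ a ∈ m) ∧ ¬ I ≤ Ideal.span {a} ⊔ m • I}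
    ((finite_setOf_isMaximal_mem ha0).subset fun m hm => hm.1) (fun m hm => hm.1.1)
    I (fun m => Ideal.span {a} ⊔ m • I) (fun m _ => le_sup_right) (fun m hm => hm.2)
  refine ⟨a, b, eq_of_forall_le_sup_smul hfg ?_ fun m hm => ?_⟩
  · rw [Ideal.span_le]
    rintro z (rfl | rfl)
    · exact haI
    · exact hbI
  have hab : Ideal.span {a} ≤ Ideal.span {a, b} := Ideal.span_mono (by simp)
  have haab : a ∈ Ideal.span {a, b} := Ideal.subset_span (by simp)
  have hbab : b ∈ Ideal.span {a, b} := Ideal.subset_span (by simp)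
  by_cases ham : I ≤ Ideal.span {a} ⊔ m • I
  · exact ham.trans (sup_le_sup_right hab _)
  by_cases haam : a ∈ m
  swap
  · obtain ⟨q, c, hc, hqc⟩ := hm.exists_inv haam
    intro i hi
    have : i = (q * i) * a + c • i := by
      rw [smul_eq_mul]; linear_combination (-i) * hqc
    rw [this]
    exact Submodule.add_mem_sup (Ideal.mul_mem_left _ _ haab) (Submodule.smul_mem_smul hc hi)
  have hbm := hb m ⟨⟨hm, haam⟩, ham⟩
  by_cases hIm : I ≤ m
  swap
  · -- locally at `m` the ideal is the unit ideal, so that any element outside `m I` generates it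
    obtain ⟨g, hgI, hgm⟩ := SetLike.not_le_iff_exists.mp hIm
    obtain ⟨q, c, hc, hqc⟩ := hm.exists_inv hgm
    have hbm' : b ∉ m := fun hbm' => hbm <| Submodule.mem_sup_right <| by
      have : b = c • b + b • (q * g) := by
        simp only [smul_eq_mul]; linear_combination (-b) * hqc
      rw [this]
      exact Submodule.add_mem _ (Submodule.smul_mem_smul hc hbI)
        (Submodule.smul_mem_smul hbm' (I.mul_mem_left _ hgI))
    obtain ⟨q, c, hc, hqc⟩ := hm.exists_inv hbm'
    intro i hi
    have : i = (q * i) * b + c • i := by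
      rw [smul_eq_mul]; linear_combination (-i) * hqc
    rw [this]
    exact Submodule.add_mem_sup (Ideal.mul_mem_left _ _ hbab) (Submodule.smul_mem_smul hc hi)
  obtain ⟨x, hx, u, hu, hxu⟩ := h m hm
  rw [Ideal.span_insert a]
  exact le_span_sup_span_of_le_span_pair hx hu hxu haI (ha m hm hIm) hbI hbm

end TwoGenerated

/-! ### Mori domains and divisorial domains -/

section Mori

variable {R K : Type*} [CommRing R] [Field K] [Algebra R K]

lemma one_div_span_singleton_mul {d : K} (hd : d ≠ 0) (B : Submodule R K) :
    1 / (Submodule.span R {d} * B) = Submodule.span R {d⁻¹} * (1 / B) :=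
  div_mul_of_mul_eq_one (span_mul_span_inv hd) 1 B

lemma span_singleton_mul_le_one {d : K} {B : Submodule R K}
    (h : ∀ b ∈ B, d * b ∈ (1 : Submodule R K)) : Submodule.span R {d} * B ≤ 1 := by
  intro x hx
  obtain ⟨b, hb, rfl⟩ := mem_span_singleton_mul_iff.mp hx
  exact h b hb

lemma span_singleton_mul_left_cancel {d : K} (hd : d ≠ 0) {A B : Submodule R K}
    (h : Submodule.span R {d} * A = Submodule.span R {d} * B) : A = B := by
  have := congrArg (Submodule.span R {d⁻¹} * ·) h
  simpa only [← mul_assoc, mul_comm (Submodule.span R {d⁻¹}) (Submodule.span R {d}),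
    span_mul_span_inv hd, one_mul] using this

lemma span_singleton_mul_ne_bot {d : K} (hd : d ≠ 0) {B : Submodule R K} (hB : B ≠ ⊥) :
    Submodule.span R {d} * B ≠ ⊥ := by
  intro h
  refine hB (span_singleton_mul_left_cancel hd ?_)
  rw [h, Submodule.mul_bot]

/-- The chain condition of a Mori domain, for divisorial fractional ideals with a common
denominator. -/
lemma _root_.IsMoriDomain.exists_forall_one_div_eq (hM : IsMoriDomain R K) {X : ℕ → Submodule R K}
    (hX : Antitone X) {d : K} (hd : d ≠ 0)
    (hle : ∀ n, ∀ y ∈ 1 / X n, d * y ∈ (1 : Submodule R K)) (hne : ∀ n, 1 / X n ≠ ⊥) :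
    ∃ n, ∀ k ≥ n, 1 / X k = 1 / X n := by
  have hle' := fun n => span_singleton_mul_le_one (hle n)
  obtain ⟨n, hn⟩ := hM
    (fun n => (Submodule.span R {d} * (1 / X n)).comap (Algebra.linearMap R K))
    (fun i j hij => Submodule.comap_mono (mul_le_mul_right (div_anti 1 (hX hij)) _)) (fun n => by
      constructor
      · intro h
        apply span_singleton_mul_ne_bot hd (hne n)
        rw [← coeSubmodule_comap (hle' n), h, IsLocalization.coeSubmodule_bot]
      · rw [IsDivisorialIdeal, coeSubmodule_comap (hle' n), one_div_span_singleton_mul hd,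
          one_div_span_singleton_mul (inv_ne_zero hd), inv_inv, one_div_one_div_one_div])
  refine ⟨n, fun k hk => span_singleton_mul_left_cancel hd ?_⟩
  rw [← coeSubmodule_comap (hle' n), ← coeSubmodule_comap (hle' k), hn k hk]

lemma isMoriDomain_of_isNoetherianRing [IsNoetherianRing R] : IsMoriDomain R K := by
  intro f hf _
  obtain ⟨n, hn⟩ := monotone_stabilizes_iff_noetherian.mpr ‹IsNoetherianRing R› ⟨f, hf⟩
  exact ⟨n, fun k hk => (hn k hk).symm⟩

lemma _root_.IsDivisorialDomain.one_div_one_div (hD : IsDivisorialDomain R K) {B : Submodule R K}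
    (hB : B ≠ ⊥) {d : K} (hd : d ≠ 0) (h : ∀ b ∈ B, d * b ∈ (1 : Submodule R K)) :
    1 / (1 / B) = B := by
  have hle := span_singleton_mul_le_one h
  have hne := span_singleton_mul_ne_bot hd hB
  have := hD ((Submodule.span R {d} * B).comap (Algebra.linearMap R K)) fun h0 => by
    rw [← coeSubmodule_comap hle, h0, IsLocalization.coeSubmodule_bot] at hne
    exact hne rfl
  rw [IsDivisorialIdeal, coeSubmodule_comap hle, one_div_span_singleton_mul hd,
    one_div_span_singleton_mul (inv_ne_zero hd), inv_inv] at this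
  exact span_singleton_mul_left_cancel hd this

lemma multiplierRing_eq_one_of_mul_eq_one {m : Ideal R} {B : Submodule R K}
    (h : coeSubmodule K m * B = 1) : multiplierRing K m = 1 := by
  calc multiplierRing K m = multiplierRing K m * coeSubmodule K m * B := by
        rw [mul_assoc, h, mul_one]
    _ = 1 := by rw [multiplierRing_mul_coeSubmodule, h]

lemma isNoetherianRing_of_isDivisorialDomain (hD : IsDivisorialDomain R K)
    (hM : IsMoriDomain R K) : IsNoetherianRing R := by
  refine monotone_stabilizes_iff_noetherian.mp fun f => ?_
  by_cases h : ∃ k, f k ≠ ⊥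
  · obtain ⟨k, hk⟩ := h
    have hne : ∀ n, f (n + k) ≠ ⊥ := fun n =>
      ne_bot_of_le_ne_bot hk (f.monotone (Nat.le_add_left k n))
    obtain ⟨n, hn⟩ := hM (fun n => f (n + k))
      (fun i j hij => f.monotone (Nat.add_le_add_right hij k)) fun n => ⟨hne n, hD _ (hne n)⟩
    refine ⟨n + k, fun j hj => ?_⟩
    have := hn (j - k) (by omega)
    rw [Nat.sub_add_cancel (by omega)] at this
    exact this.symm
  · push Not at h
    exact ⟨0, fun j _ => by rw [h, h]⟩

lemma isStableQuadratic_of_mul_one_div_eq_one {m : Ideal R}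
    (h : coeSubmodule K m * (1 / coeSubmodule K m) = 1) : IsStableQuadratic K m := by
  constructor
  · rw [multiplierRing_eq_one_of_mul_eq_one h, h]
  · exact multiplierRing_eq_one_of_mul_eq_one h ▸ WCovBy.rfl

variable [IsFractionRing R K]

lemma coeSubmodule_injective : Function.Injective (coeSubmodule K : Ideal R → Submodule R K) :=
  IsFractionRing.coeSubmodule_injective R K

lemma _root_.IsMoriDomain.exists_fg_one_div_eq (hM : IsMoriDomain R K) {m : Ideal R} (hm0 : m ≠ ⊥) :
    ∃ J : Ideal R, J ≠ ⊥ ∧ J.FG ∧ J ≤ m ∧ 1 / coeSubmodule K J = 1 / coeSubmodule K m := by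
  by_contra! hcon
  have hstep : ∀ J : {J : Ideal R // J ≠ ⊥ ∧ J.FG ∧ J ≤ m},
      ∃ J' : {J : Ideal R // J ≠ ⊥ ∧ J.FG ∧ J ≤ m}, J ≤ J' ∧
        1 / coeSubmodule K (J' : Ideal R) ≠ 1 / coeSubmodule K (J : Ideal R) := by
    rintro ⟨J, hJ0, hJfg, hJm⟩
    have hle := div_anti (1 : Submodule R K) (IsLocalization.coeSubmodule_mono K hJm)
    obtain ⟨z, hzJ, hzm⟩ := SetLike.exists_of_lt (lt_of_le_of_ne hle (hcon J hJ0 hJfg hJm).symm)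
    rw [Submodule.mem_div_iff_forall_mul_mem] at hzm
    push Not at hzm
    obtain ⟨y, hy, hzy⟩ := hzm
    obtain ⟨y, hym, rfl⟩ := (IsLocalization.mem_coeSubmodule K m).mp hy
    refine ⟨⟨J ⊔ Ideal.span {y}, ne_bot_of_le_ne_bot hJ0 le_sup_left,
      Submodule.FG.sup hJfg (Submodule.fg_span_singleton y),
      sup_le hJm ((Ideal.span_singleton_le_iff_mem _).mpr hym)⟩, le_sup_left (a := J), fun h => ?_⟩
    rw [← h] at hzJ
    exact hzy (mul_mem_of_mem_div hzJ (algebraMap_mem_coeSubmodule.mpr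
      (Submodule.mem_sup_right (Ideal.mem_span_singleton_self y))))
  choose next hnext using hstep
  obtain ⟨c, hc, hc0⟩ := m.ne_bot_iff.mp hm0
  let J : ℕ → {J : Ideal R // J ≠ ⊥ ∧ J.FG ∧ J ≤ m} := fun n => next^[n]
    ⟨Ideal.span {c}, by simpa using hc0, Submodule.fg_span_singleton c,
      (Ideal.span_singleton_le_iff_mem _).mpr hc⟩
  have hJ : ∀ n, J (n + 1) = next (J n) := fun n => Function.iterate_succ_apply' _ _ _
  have hmono : Monotone J := monotone_nat_of_le_succ fun n => by
    rw [hJ]; exact (hnext (J n)).1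
  obtain ⟨n, hn⟩ := hM.exists_forall_one_div_eq
    (X := fun n => 1 / coeSubmodule K (J n : Ideal R)) (fun i j hij => div_anti 1
      (IsLocalization.coeSubmodule_mono K (hmono hij))) one_ne_zero (fun n y hy => by
        have h1 : (1 : Submodule R K) ≤ 1 / coeSubmodule K (J n : Ideal R) :=
          Submodule.one_le_one_div.mpr (coeSubmodule_le_one _)
        have := div_anti (1 : Submodule R K) h1 hy
        rw [div_one_eq] at this
        rwa [one_mul])
    (fun n => ne_bot_of_le_ne_bot (coeSubmodule_ne_bot (J n).2.1) (le_one_div_one_div _))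
  apply (hnext (J n)).2
  have := congrArg (1 / ·) (hn (n + 1) n.le_succ)
  simpa only [one_div_one_div_one_div, hJ] using this

lemma _root_.IsDivisorialDomain.wcovBy_one_div (hD : IsDivisorialDomain R K) {m : Ideal R}
    [hm : m.IsMaximal] (hm0 : m ≠ ⊥) : 1 ⩿ 1 / coeSubmodule K m := by
  refine ⟨Submodule.one_le_one_div.mpr (coeSubmodule_le_one m), fun B h1 h2 => ?_⟩
  obtain ⟨d, hd, hd0⟩ := (Submodule.ne_bot_iff _).mp (coeSubmodule_ne_bot (K := K) hm0)
  have hB : 1 / (1 / B) = B := by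
    refine hD.one_div_one_div (ne_bot_of_gt h1) hd0 fun b hb => ?_
    rw [mul_comm]
    exact mul_mem_of_mem_div (h2.le hb) hd
  have hle : 1 / B ≤ 1 := by
    have := div_anti (1 : Submodule R K) h1.le
    rwa [div_one_eq] at this
  have hmB : coeSubmodule K m ≤ 1 / B := (le_one_div_one_div _).trans (div_anti 1 h2.le)
  obtain ⟨J, hJ⟩ : ∃ J : Ideal R, coeSubmodule K J = 1 / B := ⟨_, coeSubmodule_comap hle⟩
  rw [← hJ] at hmB hB
  rcases eq_or_ne J ⊤ with rfl | hJ1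
  · rw [IsLocalization.coeSubmodule_top, div_one_eq] at hB
    exact h1.ne hB
  · rw [← hm.eq_of_le hJ1 (IsFractionRing.coeSubmodule_le_coeSubmodule.mp hmB)] at hB
    exact h2.ne hB.symm

lemma one_le_coeSubmodule_iff {I : Ideal R} : 1 ≤ coeSubmodule K I ↔ I = ⊤ := by
  rw [← IsLocalization.coeSubmodule_top, IsFractionRing.coeSubmodule_le_coeSubmodule, top_le_iff]

/-- A maximal ideal `m` is invertible, or its inverse is the multiplier ring. -/
lemma mul_one_div_eq_one_or (m : Ideal R) [hm : m.IsMaximal] :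
    coeSubmodule K m * (1 / coeSubmodule K m) = 1 ∨
      1 / coeSubmodule K m = multiplierRing K m := by
  have hle : coeSubmodule K m * (1 / coeSubmodule K m) ≤ 1 := Submodule.mul_one_div_le_one
  have hmle : coeSubmodule K m ≤ coeSubmodule K m * (1 / coeSubmodule K m) :=
    Submodule.le_self_mul_one_div (coeSubmodule_le_one m)
  obtain ⟨J, hJ⟩ : ∃ J : Ideal R, coeSubmodule K J = coeSubmodule K m * (1 / coeSubmodule K m) :=
    ⟨_, coeSubmodule_comap hle⟩
  rw [← hJ] at hmle ⊢
  rcases eq_or_ne J ⊤ with rfl | hJ1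
  · exact Or.inl (IsLocalization.coeSubmodule_top K)
  · right
    rw [← hm.eq_of_le hJ1 (IsFractionRing.coeSubmodule_le_coeSubmodule.mp hmle)] at hJ
    refine le_antisymm ?_ multiplierRing_le
    rw [multiplierRing, Submodule.le_div_iff_mul_le, mul_comm, ← hJ]

lemma _root_.IsDivisorialDomain.isStableQuadratic (hR : IsSeminormalDomain R K)
    (hD : IsDivisorialDomain R K) [IsNoetherianRing R] (m : Ideal R) [hm : m.IsMaximal]
    (hm0 : m ≠ ⊥) : IsStableQuadratic K m := by
  rcases mul_one_div_eq_one_or (K := K) m with h | h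
  · exact isStableQuadratic_of_mul_one_div_eq_one h
  have hcov : 1 ⩿ multiplierRing K m := h ▸ hD.wcovBy_one_div hm0
  refine ⟨?_, hcov⟩
  set E := multiplierRing K m with hEdef
  set N := coeSubmodule K m
  set A := N * (E / N) with hA
  have hAE : A ≤ E := by rw [hA, mul_comm]; exact div_mul_le _ _
  have hNA : N ≤ A := by
    have : N * 1 ≤ A := mul_le_mul_right
      (Submodule.one_le.mpr (Submodule.one_mem_div.mpr coeSubmodule_le_multiplierRing)) N
    rwa [mul_one] at this
  have hEA : E * A ≤ A := by
    rw [hA, ← mul_assoc, multiplierRing_mul_coeSubmodule]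
  obtain ⟨A', hAA'⟩ := exists_mul_eq_of_wcovBy hcov
    (fun y hy hy2 => isReduced_of_isSeminormalDomain hR hy hy2) hNA hAE hEA
  -- `A = N (E : N)` is a trace ideal, so `(E : A) A ≤ A`
  have hFA : E / A * A ≤ A := by
    have h1 : E / A * (E / N) ≤ E / N := by
      rw [Submodule.le_div_iff_mul_le, mul_assoc, mul_comm (E / N) N]
      exact div_mul_le _ _
    calc E / A * A = N * (E / A * (E / N)) := by rw [hA]; ring
      _ ≤ A := mul_le_mul_right h1 N
  have hFE : E / A ≤ E := by
    rw [hEdef, multiplierRing, Submodule.le_div_iff_mul_le]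
    change E / A * N ≤ N
    calc E / A * N = E / A * A * A' := by rw [mul_assoc, hAA']
      _ ≤ A * A' := mul_le_mul_left hFA A'
      _ = N := hAA'
  -- dualizing, `N A` and `N` have the same inverse
  have hNA' : N * A ≤ N := (mul_le_mul_right hAE N).trans
    (by rw [mul_comm]; exact multiplierRing_mul_coeSubmodule.le)
  have hdual : 1 / N ≤ 1 / (N * A) := div_anti 1 hNA'
  have hdual' : 1 / (N * A) ≤ 1 / N := by rw [← div_div_eq, h]; exact hFE
  have hN0 : N ≠ ⊥ := coeSubmodule_ne_bot hm0
  have hA0 : A ≠ ⊥ := ne_bot_of_le_ne_bot hN0 hNA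
  have heq : N * A = N := by
    have h1 : 1 / (1 / (N * A)) = N * A := by
      refine hD.one_div_one_div (d := 1) ?_ one_ne_zero fun b hb => ?_
      · rw [Ne, ← Submodule.zero_eq_bot, mul_eq_zero]
        simpa [Submodule.zero_eq_bot] using ⟨hN0, hA0⟩
      · rw [one_mul]; exact coeSubmodule_le_one m (hNA' hb)
    rw [← h1, le_antisymm hdual' hdual]
    exact hD m hm0
  have h1 : (1 : K) ∈ A := one_mem_of_le_mul one_le_multiplierRing multiplierRing_mul_self.le hAE
    hEA (fg_of_le_multiplierRing hm0 coeSubmodule_le_multiplierRing) hN0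
    (by rw [mul_comm]; exact heq.ge)
  refine le_antisymm hAE ?_
  calc E = E * 1 := (mul_one E).symm
    _ ≤ E * A := mul_le_mul_right (Submodule.one_le.mpr h1) E
    _ ≤ A := hEA

end Mori

/-! ### Algebras of dimension at most two over a field -/

section Quadratic

variable {k A : Type*} [Field k] [CommRing A] [Algebra k A]

lemma exists_eq_add_mul_of_span_pair_eq_top {u v : A} (h : Submodule.span k {u, v} = ⊤) {y : A}
    (hy : ∀ a : k, y ≠ algebraMap k A a) (z : A) :
    ∃ a b : k, z = algebraMap k A a + algebraMap k A b * y := by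
  have : Nontrivial A := ⟨⟨y, algebraMap k A 0, hy 0⟩⟩
  classical
  have hfin : Module.Finite k A := ⟨⟨{u, v}, by simpa using h⟩⟩
  have hrank : Module.finrank k A ≤ 2 := by
    have h1 := finrank_span_finset_le_card (R := k) ({u, v} : Finset A)
    rw [Finset.coe_pair, Set.finrank, h, finrank_top] at h1
    exact h1.trans Finset.card_le_two
  have hdep : ¬ LinearIndependent k ![1, y, z] := fun hli => by
    have := hli.fintype_card_le_finrank
    simp only [Fintype.card_fin] at this
    omega
  obtain ⟨g, hg, i, hi⟩ := Fintype.not_linearIndependent_iff.mp hdep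
  simp only [Fin.sum_univ_three, Matrix.cons_val_zero, Matrix.cons_val_one, Matrix.cons_val,
    Algebra.smul_def] at hg
  have hunit : ∀ c : k, c ≠ 0 → algebraMap k A c⁻¹ * algebraMap k A c = 1 := fun c hc => by
    rw [← map_mul, inv_mul_cancel₀ hc, map_one]
  by_cases h2 : g 2 = 0
  · exfalso
    rw [h2, map_zero, zero_mul, add_zero] at hg
    by_cases h1 : g 1 = 0
    · rw [h1, map_zero, zero_mul, add_zero, mul_one] at hg
      have h0 : g 0 = 0 := (map_eq_zero_iff _ (algebraMap k A).injective).mp hg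
      fin_cases i <;> simp_all
    · apply hy (-((g 1)⁻¹ * g 0))
      rw [map_neg, map_mul]
      linear_combination algebraMap k A (g 1)⁻¹ * hg - y * hunit _ h1
  · refine ⟨-((g 2)⁻¹ * g 0), -((g 2)⁻¹ * g 1), ?_⟩
    simp only [map_neg, map_mul]
    linear_combination algebraMap k A (g 2)⁻¹ * hg - z * hunit _ h2

variable (k A) in
/-- Every finitely generated subspace `V` of `A` that generates the unit ideal and whose ring of
multipliers `{s | s V ⊆ V}` is just `k` is a line. -/
def LinesOfTrivialMultipliers : Prop :=
  ∀ V : Submodule k A, V.FG → Ideal.span (V : Set A) = ⊤ →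
    (∀ s, (∀ v ∈ V, s * v ∈ V) → ∃ a : k, s = algebraMap k A a) → ∃ v, V ≤ Submodule.span k {v}

lemma exists_multiplier (H : LinesOfTrivialMultipliers k A) {V : Submodule k A} (hV : V.FG)
    (h1 : (1 : A) ∈ V) {y : A} (hyV : y ∈ V) (hy : ∀ a : k, y ≠ algebraMap k A a) :
    ∃ s ∈ V, (∀ v ∈ V, s * v ∈ V) ∧ ∀ a : k, s ≠ algebraMap k A a := by
  by_contra! hcon
  obtain ⟨v, hv⟩ := H V hV ((Ideal.eq_top_iff_one _).mpr (Ideal.subset_span h1))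
    fun s hs => hcon s (by simpa using hs 1 h1) hs
  obtain ⟨a, ha⟩ := Submodule.mem_span_singleton.mp (hv h1)
  obtain ⟨b, hb⟩ := Submodule.mem_span_singleton.mp (hv hyV)
  have : Nontrivial A := ⟨⟨y, algebraMap k A 0, hy 0⟩⟩
  have ha0 : a ≠ 0 := by
    rintro rfl
    rw [zero_smul] at ha
    exact zero_ne_one ha
  apply hy (b * a⁻¹)
  have hunit : algebraMap k A a⁻¹ * algebraMap k A a = 1 := by
    rw [← map_mul, inv_mul_cancel₀ ha0, map_one]
  rw [Algebra.smul_def] at ha hb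
  rw [← hb, map_mul]
  linear_combination (-algebraMap k A b * v) * hunit + algebraMap k A b * algebraMap k A a⁻¹ * ha

lemma exists_mul_self_eq (H : LinesOfTrivialMultipliers k A) (y : A) :
    ∃ a b : k, y * y = algebraMap k A a + algebraMap k A b * y := by
  by_cases hy : ∃ a : k, y = algebraMap k A a
  · obtain ⟨a, rfl⟩ := hy
    exact ⟨0, a, by rw [map_zero, zero_add]⟩
  push Not at hy
  obtain ⟨s, hs, hsV, hsk⟩ := exists_multiplier H (V := Submodule.span k {1, y})
    (Submodule.fg_span (Set.toFinite _)) (Submodule.subset_span (by simp))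
    (Submodule.subset_span (by simp)) hy
  obtain ⟨a, b, rfl⟩ := Submodule.mem_span_pair.mp hs
  obtain ⟨c, d, hcd⟩ := Submodule.mem_span_pair.mp (hsV y (Submodule.subset_span (by simp)))
  simp only [Algebra.smul_def, mul_one] at hsk hcd
  have hb : b ≠ 0 := by
    rintro rfl
    exact hsk a (by simp)
  have hunit : algebraMap k A b⁻¹ * algebraMap k A b = 1 := by
    rw [← map_mul, inv_mul_cancel₀ hb, map_one]
  refine ⟨b⁻¹ * c, b⁻¹ * (d - a), ?_⟩
  simp only [map_mul, map_sub]
  linear_combination (-algebraMap k A b⁻¹) * hcd - y * y * hunit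

/-- For an idempotent `e` and `f` with `e f = 0`, where `1`, `e`, `f` are independent, the plane
spanned by `e + f` and `1 - e` has only scalar multipliers. -/
lemma exists_eq_add_mul_of_mul_eq_zero (H : LinesOfTrivialMultipliers k A) {e f : A}
    (he : e * e = e) (hek : ∀ a : k, e ≠ algebraMap k A a) (hef : e * f = 0) :
    ∃ a b : k, f = algebraMap k A a + algebraMap k A b * e := by
  by_contra! hcon
  have hinv : ∀ c : k, c ≠ 0 → algebraMap k A c⁻¹ * algebraMap k A c = 1 := fun c hc => by
    rw [← map_mul, inv_mul_cancel₀ hc, map_one]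
  have hce : ∀ c : k, algebraMap k A c * e = 0 → c = 0 := by
    intro c hc
    by_contra hc0
    apply hek 0
    rw [map_zero]
    linear_combination algebraMap k A c⁻¹ * hc - e * hinv c hc0
  have hce' : ∀ c : k, algebraMap k A c * (1 - e) = 0 → c = 0 := by
    intro c hc
    by_contra hc0
    apply hek 1
    rw [map_one]
    linear_combination (-algebraMap k A c⁻¹) * hc + (1 - e) * hinv c hc0
  have hcf : ∀ c d : k, algebraMap k A c * f = algebraMap k A d * (1 - e) → c = 0 := by
    intro c d hc
    by_contra hc0
    apply hcon (c⁻¹ * d) (-(c⁻¹ * d))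
    simp only [map_neg, map_mul]
    linear_combination algebraMap k A c⁻¹ * hc - f * hinv c hc0
  have hmem1 : e + f ∈ Submodule.span k {e + f, 1 - e} := Submodule.subset_span (by simp)
  have hmem2 : 1 - e ∈ Submodule.span k {e + f, 1 - e} := Submodule.subset_span (by simp)
  obtain ⟨v, hv⟩ := H (Submodule.span k {e + f, 1 - e}) (Submodule.fg_span (Set.toFinite _)) (by
      rw [Ideal.eq_top_iff_one]
      have h1 : e * (e + f) + (1 - e) = 1 := by linear_combination he + hef
      have := Ideal.add_mem _ (Ideal.mul_mem_left _ e (Ideal.subset_span hmem1))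
        (Ideal.subset_span hmem2)
      rwa [h1] at this)
    (fun s hs => by
      obtain ⟨a, b, h1⟩ := Submodule.mem_span_pair.mp (hs _ hmem2)
      obtain ⟨c, d, h2⟩ := Submodule.mem_span_pair.mp (hs _ hmem1)
      simp only [Algebra.smul_def] at h1 h2
      have ha : a = 0 := hce a (by
        linear_combination e * h1 + (-algebraMap k A a + algebraMap k A b - s) * he
          - algebraMap k A a * hef)
      rw [ha, map_zero, zero_mul, zero_add] at h1
      -- comparing components: `s = b` on the component of `1 - e`, and `s = c` on that of `e`
      have hcb : b - c = 0 := hcf (b - c) d (by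
        rw [map_sub]
        linear_combination f * h1 + (1 - e) * (-h2) +
          (algebraMap k A d - algebraMap k A c + s) * he
          + (algebraMap k A b - algebraMap k A c) * hef)
      have hd : d = 0 := hce' d (by
        have hcb' : algebraMap k A b - algebraMap k A c = 0 := by rw [← map_sub, hcb, map_zero]
        linear_combination (1 - e) * h2 - f * h1 + f * hcb'
          + (- algebraMap k A d + algebraMap k A c - s) * he +
          (algebraMap k A c - algebraMap k A b) * hef)
      rw [hd, map_zero, zero_mul, add_zero] at h2
      refine ⟨b, ?_⟩
      have hcb' : algebraMap k A b - algebraMap k A c = 0 := by rw [← map_sub, hcb, map_zero]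
      linear_combination (-1 : A) * h1 - e * h2 + (algebraMap k A c - s) * he
        + (algebraMap k A c - s) * hef - e * hcb')
  obtain ⟨p, hp⟩ := Submodule.mem_span_singleton.mp (hv hmem1)
  obtain ⟨q, hq⟩ := Submodule.mem_span_singleton.mp (hv hmem2)
  rw [Algebra.smul_def] at hp hq
  have hq0 : q = 0 := hce q (by
    linear_combination (algebraMap k A p * e) * hq - (algebraMap k A q * e) * hp +
      (- algebraMap k A p - algebraMap k A q) * he - algebraMap k A q * hef)
  apply hek 1
  rw [map_one]
  rw [hq0, map_zero, zero_mul] at hq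
  linear_combination hq

/-- A reduced algebra in which every finitely generated subspace that generates the unit ideal and
has only scalar multipliers is a line has dimension at most two. -/
lemma exists_eq_add_mul_of_linesOfTrivialMultipliers [IsReduced A]
    (H : LinesOfTrivialMultipliers k A) {y : A} (hy : ∀ a : k, y ≠ algebraMap k A a) (z : A) :
    ∃ a b : k, z = algebraMap k A a + algebraMap k A b * y := by
  have hinv : ∀ c : k, c ≠ 0 → algebraMap k A c⁻¹ * algebraMap k A c = 1 := fun c hc => by
    rw [← map_mul, inv_mul_cancel₀ hc, map_one]
  by_cases hidem : ∃ e : A, e * e = e ∧ ∀ a : k, e ≠ algebraMap k A a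
  · obtain ⟨e, he, hek⟩ := hidem
    have hall : ∀ x : A, ∃ a b : k, x = algebraMap k A a + algebraMap k A b * e := by
      intro x
      obtain ⟨a, b, hab⟩ := exists_eq_add_mul_of_mul_eq_zero H (e := e) (f := (1 - e) * x) he hek
        (by linear_combination (-x) * he)
      obtain ⟨c, d, hcd⟩ := exists_eq_add_mul_of_mul_eq_zero H (e := 1 - e) (f := e * x)
        (by linear_combination he) (fun a h => hek (1 - a) (by
          rw [map_sub, map_one, ← h]; ring)) (by linear_combination (-x) * he)
      refine ⟨a + c + d, b - d, ?_⟩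
      simp only [map_add, map_sub]
      linear_combination hab + hcd
    obtain ⟨a, b, hab⟩ := hall y
    obtain ⟨c, d, hcd⟩ := hall z
    have hb : b ≠ 0 := by
      rintro rfl
      exact hy a (by rw [hab, map_zero, zero_mul, add_zero])
    refine ⟨c - d * b⁻¹ * a, d * b⁻¹, ?_⟩
    simp only [map_sub, map_mul]
    linear_combination hcd - (algebraMap k A d * algebraMap k A b⁻¹) * hab
      - (algebraMap k A d * e) * hinv b hb
  push Not at hidem
  -- without nontrivial idempotents, non-scalar elements are units
  have hunit : ∀ w : A, (∀ a : k, w ≠ algebraMap k A a) → ∃ a b : k, a ≠ 0 ∧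
      w * (w - algebraMap k A b) = algebraMap k A a := by
    intro w hw
    obtain ⟨a, b, hab⟩ := exists_mul_self_eq H w
    refine ⟨a, b, ?_, by linear_combination hab⟩
    rintro rfl
    rw [map_zero, zero_add] at hab
    by_cases hb : b = 0
    · rw [hb, map_zero, zero_mul] at hab
      exact hw 0 (by rw [map_zero]; exact (IsNilpotent.eq_zero ⟨2, by rw [pow_two, hab]⟩))
    · obtain ⟨c, hc⟩ := hidem (algebraMap k A b⁻¹ * w) (by
        linear_combination (algebraMap k A b⁻¹ * algebraMap k A b⁻¹) * hab
          + algebraMap k A b⁻¹ * w * hinv b hb)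
      apply hw (b * c)
      rw [map_mul, ← hc]
      linear_combination (-w) * hinv b hb
  by_contra! hz
  obtain ⟨s, hs, hsV, hsk⟩ := exists_multiplier H (V := Submodule.span k {1, y, z})
    (Submodule.fg_span (Set.toFinite _)) (Submodule.subset_span (by simp))
    (Submodule.subset_span (by simp)) hy
  -- the solid `span {1, y, z}` is spanned by `1`, `s` and a third element `t`
  obtain ⟨t, ht, p, q, r, hpqr⟩ : ∃ t : A,
      (∀ a b : k, t ≠ algebraMap k A a + algebraMap k A b * s) ∧ ∃ p q r : k,
        s * t = algebraMap k A p + algebraMap k A q * s + algebraMap k A r * t := by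
    obtain ⟨a, b, c, habc⟩ := Submodule.mem_span_triple.mp hs
    simp only [Algebra.smul_def, mul_one] at habc
    by_cases hc : c = 0
    · subst hc
      rw [map_zero, zero_mul, add_zero] at habc
      have hb : b ≠ 0 := by
        rintro rfl
        exact hsk a (by rw [← habc, map_zero, zero_mul, add_zero])
      obtain ⟨a', b', c', h'⟩ := Submodule.mem_span_triple.mp
        (hsV z (Submodule.subset_span (by simp)))
      simp only [Algebra.smul_def, mul_one] at h'
      refine ⟨z, fun p q h => hz (p + q * a) (q * b) ?_, a' - b' * b⁻¹ * a, b' * b⁻¹, c', ?_⟩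
      · simp only [map_add, map_mul]
        linear_combination h - algebraMap k A q * habc
      · simp only [map_sub, map_mul]
        linear_combination (-1 : A) * h' + (algebraMap k A b' * algebraMap k A b⁻¹) * habc
          - (algebraMap k A b' * y) * hinv b hb
    · obtain ⟨a', b', c', h'⟩ := Submodule.mem_span_triple.mp
        (hsV y (Submodule.subset_span (by simp)))
      simp only [Algebra.smul_def, mul_one] at h'
      refine ⟨y, fun p q h => ?_, a' - c' * c⁻¹ * a, c' * c⁻¹, b' - c' * c⁻¹ * b, ?_⟩
      · have hq : q ≠ 0 := by
          rintro rfl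
          exact hy p (by rw [h, map_zero, zero_mul, add_zero])
        apply hz (c⁻¹ * (-(q⁻¹ * p) - a)) (c⁻¹ * (q⁻¹ - b))
        simp only [map_sub, map_mul, map_neg]
        linear_combination (algebraMap k A c⁻¹) * habc - z * hinv c hc
          - (algebraMap k A c⁻¹ * algebraMap k A q⁻¹) * h
          - (algebraMap k A c⁻¹ * s) * hinv q hq
      · simp only [map_sub, map_mul]
        linear_combination (-1 : A) * h' + (algebraMap k A c' * algebraMap k A c⁻¹) * habc
          - (algebraMap k A c' * z) * hinv c hc
  obtain ⟨a, b, ha, hab⟩ := hunit (s - algebraMap k A r) fun c h => hsk (c + r) (by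
    rw [map_add]; linear_combination h)
  obtain ⟨c, d, hcd⟩ := exists_mul_self_eq H s
  -- `t = a⁻¹ (s - r - b) (p + q s)`
  apply ht (a⁻¹ * (-(r + b) * p + q * c)) (a⁻¹ * (p - (r + b) * q + q * d))
  simp only [map_sub, map_mul, map_neg, map_add]
  linear_combination (algebraMap k A a⁻¹ * (s - algebraMap k A r - algebraMap k A b)) * hpqr
    - (algebraMap k A a⁻¹ * t) * hab - t * hinv a ha + (algebraMap k A a⁻¹ * algebraMap k A q) * hcd

end Quadratic

/-! ### The residue algebra of the multiplier ring -/

section ResidueAlgebra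

variable {R : Type*} (K : Type*) [CommRing R] [Field K] [Algebra R K]

/-- The multiplier ring `(m : m)` as a subalgebra of `K`. -/
def multiplierSubalgebra (m : Ideal R) : Subalgebra R K :=
  (multiplierRing K m).toSubalgebra one_mem_multiplierRing fun _ _ => mul_mem_multiplierRing

/-- The ideal `m` of `R` as an ideal of `(m : m)`. -/
def idealOfMultiplier (m : Ideal R) : Ideal (multiplierSubalgebra K m) where
  carrier := {e | (e : K) ∈ coeSubmodule K m}
  zero_mem' := (coeSubmodule K m).zero_mem
  add_mem' := fun ha hb => (coeSubmodule K m).add_mem ha hb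
  smul_mem' := fun c _ hx => mul_mem_of_mem_div c.2 hx

/-- The residue algebra `(m : m) / m`. -/
abbrev ResidueAlgebra (m : Ideal R) : Type _ :=
  multiplierSubalgebra K m ⧸ idealOfMultiplier K m

/-- The residue class in `(m : m) / m` of an element of `(m : m)`. -/
abbrev residueMk (m : Ideal R) : multiplierSubalgebra K m →+* ResidueAlgebra K m :=
  Ideal.Quotient.mk (idealOfMultiplier K m)

variable {K} {m : Ideal R}

lemma mem_idealOfMultiplier {e : multiplierSubalgebra K m} :
    e ∈ idealOfMultiplier K m ↔ (e : K) ∈ coeSubmodule K m :=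
  Iff.rfl

lemma residueMk_eq_iff {a b : multiplierSubalgebra K m} :
    residueMk K m a = residueMk K m b ↔ (a : K) - b ∈ coeSubmodule K m := by
  rw [Ideal.Quotient.eq, mem_idealOfMultiplier]
  rfl

lemma isReduced_residueAlgebra
    (hred : ∀ x ∈ multiplierRing K m, x * x ∈ coeSubmodule K m → x ∈ coeSubmodule K m) :
    IsReduced (ResidueAlgebra K m) := by
  rw [isReduced_iff_pow_one_lt 2 one_lt_two]
  intro x hx
  obtain ⟨e, rfl⟩ := Ideal.Quotient.mk_surjective x
  rw [pow_two, ← map_mul, Ideal.Quotient.eq_zero_iff_mem] at hx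
  exact Ideal.Quotient.eq_zero_iff_mem.mpr (hred e e.2 hx)

instance [IsFractionRing R K] : Algebra (R ⧸ m) (ResidueAlgebra K m) :=
  Ideal.Quotient.algebraQuotientOfLEComap fun _ hr =>
    mem_idealOfMultiplier.mpr (algebraMap_mem_coeSubmodule.mpr hr)

variable [IsFractionRing R K]

lemma algebraMap_residueAlgebra (r : R) :
    algebraMap (R ⧸ m) (ResidueAlgebra K m) (Ideal.Quotient.mk m r) =
      residueMk K m (algebraMap R _ r) :=
  rfl

lemma smul_residueMk (r : R) (e : multiplierSubalgebra K m) :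
    Ideal.Quotient.mk m r • residueMk K m e = residueMk K m (r • e) := by
  have h1 := Algebra.smul_def (Ideal.Quotient.mk m r) (residueMk K m e)
  rw [h1, algebraMap_residueAlgebra, Algebra.smul_def, map_mul]

lemma mem_one_of_residueMk_eq {e : multiplierSubalgebra K m} {a : R ⧸ m}
    (h : residueMk K m e = algebraMap _ _ a) : (e : K) ∈ (1 : Submodule R K) := by
  obtain ⟨r, rfl⟩ := Ideal.Quotient.mk_surjective a
  rw [algebraMap_residueAlgebra, residueMk_eq_iff] at h
  have := Submodule.add_mem _ (coeSubmodule_le_one m h) (Submodule.algebraMap_mem r)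
  have h2 : ((algebraMap R (multiplierSubalgebra K m) r : multiplierSubalgebra K m) : K) =
    algebraMap R K r := rfl
  rwa [h2, sub_add_cancel] at this

/-- If `(m : m) / m` has dimension at most two over `R / m`, then no module lies strictly between
`R` and `(m : m)`. -/
lemma wcovBy_multiplierRing
    (h : ∀ y z : ResidueAlgebra K m, (∀ a : R ⧸ m, y ≠ algebraMap _ _ a) →
      ∃ a b : R ⧸ m, z = algebraMap _ _ a + algebraMap _ _ b * y) : 1 ⩿ multiplierRing K m := by
  refine ⟨one_le_multiplierRing, fun B h1 h2 => ?_⟩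
  obtain ⟨y, hyB, hy1⟩ := SetLike.exists_of_lt h1
  obtain ⟨z, hzE, hzB⟩ := SetLike.exists_of_lt h2
  let y' : multiplierSubalgebra K m := ⟨y, h2.le hyB⟩
  let z' : multiplierSubalgebra K m := ⟨z, hzE⟩
  obtain ⟨a, b, hab⟩ := h (residueMk K m y') (residueMk K m z')
    fun a ha => hy1 (mem_one_of_residueMk_eq ha)
  obtain ⟨a, rfl⟩ := Ideal.Quotient.mk_surjective a
  obtain ⟨b, rfl⟩ := Ideal.Quotient.mk_surjective b
  rw [algebraMap_residueAlgebra, algebraMap_residueAlgebra, ← map_mul, ← map_add,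
    residueMk_eq_iff] at hab
  have h3 : z - (algebraMap R K a + algebraMap R K b * y) ∈ B :=
    h1.le (coeSubmodule_le_one m hab)
  apply hzB
  have h4 := B.add_mem h3 (B.add_mem (algebraMap_mem_of_one_le h1.le a)
    (algebraMap_mul_mem B b hyB))
  rwa [sub_add_cancel] at h4

lemma wcovBy_multiplierRing_of_eq_span_pair [hm : m.IsMaximal] {u v : K}
    (h : multiplierRing K m = Submodule.span R {u, v}) : 1 ⩿ multiplierRing K m := by
  let _ := Ideal.Quotient.field m
  have hu : u ∈ multiplierRing K m := h ▸ Submodule.subset_span (by simp)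
  have hv : v ∈ multiplierRing K m := h ▸ Submodule.subset_span (by simp)
  let u' : multiplierSubalgebra K m := ⟨u, hu⟩
  let v' : multiplierSubalgebra K m := ⟨v, hv⟩
  refine wcovBy_multiplierRing fun y z hy => exists_eq_add_mul_of_span_pair_eq_top
    (u := residueMk K m u') (v := residueMk K m v') ?_ hy z
  rw [eq_top_iff]
  intro x _
  obtain ⟨e, rfl⟩ := Ideal.Quotient.mk_surjective x
  have he : (e : K) ∈ Submodule.span R {u, v} := h ▸ e.2
  obtain ⟨a, b, hab⟩ := Submodule.mem_span_pair.mp he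
  refine Submodule.mem_span_pair.mpr ⟨Ideal.Quotient.mk m a, Ideal.Quotient.mk m b, ?_⟩
  have : e = a • u' + b • v' := Subtype.ext hab.symm
  rw [this, map_add, ← smul_residueMk, ← smul_residueMk]

/-- Finite stability forces a subspace of `(m : m) / m` whose only multipliers are scalars to be a
line: it lifts to a finitely generated `N` with `(N : N) = R`, which is then invertible in `R`. -/
lemma linesOfTrivialMultipliers_residueAlgebra [hm : m.IsMaximal]
    (hS : ∀ N : Submodule R K, N ≤ multiplierRing K m → N ≠ ⊥ → N.FG →
      N * (N / N / N) = N / N) :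
    @LinesOfTrivialMultipliers (R ⧸ m) (ResidueAlgebra K m) (Ideal.Quotient.field m) _ _ := by
  let _ := Ideal.Quotient.field m
  intro V hVfg hVtop hVmul
  have hsurj : Function.Surjective (residueMk K m) := Ideal.Quotient.mk_surjective
  obtain ⟨s, hs⟩ := hVfg
  obtain ⟨g, hg⟩ := hsurj.hasRightInverse
  have hspan : Ideal.span (s : Set (ResidueAlgebra K m)) = ⊤ := by
    rw [← hVtop, ← hs]
    refine le_antisymm (Ideal.span_mono Submodule.subset_span) (Ideal.span_le.mpr fun x hx => ?_)
    refine Submodule.span_induction (fun y hy => Ideal.subset_span hy) (Ideal.zero_mem _)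
      (fun _ _ _ _ => Ideal.add_mem _) (fun a y _ hy => ?_) hx
    rw [Algebra.smul_def]
    exact Ideal.mul_mem_left _ _ hy
  obtain ⟨f, -, hf⟩ := Submodule.mem_span_finset.mp ((Ideal.eq_top_iff_one _).mp hspan)
  let c : multiplierSubalgebra K m := 1 - ∑ x ∈ s, g (f x) * g x
  have hc : residueMk K m c = 0 := by
    simp only [c, map_sub, map_one, map_sum, map_mul]
    rw [← hf, sub_eq_zero]
    refine Finset.sum_congr rfl fun x _ => ?_
    rw [hg, hg, smul_eq_mul]
  let N' : Submodule R (multiplierSubalgebra K m) :=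
    Submodule.span R (insert c (g '' (s : Set (ResidueAlgebra K m))))
  let N : Submodule R K := N'.map (multiplierSubalgebra K m).val.toLinearMap
  have hNmem : ∀ x : multiplierSubalgebra K m, (x : K) ∈ N ↔ x ∈ N' := by
    intro x
    constructor
    · rintro ⟨y, hy, hyx⟩
      rwa [← Subtype.ext hyx]
    · exact fun h => ⟨x, h, rfl⟩
  have hNE : N ≤ multiplierRing K m := by
    rintro _ ⟨y, -, rfl⟩
    exact y.2
  have hNV : ∀ x ∈ N', residueMk K m x ∈ V := by
    intro x hx
    refine Submodule.span_induction ?_ ?_ ?_ ?_ hx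
    · rintro y (rfl | ⟨z, hz, rfl⟩)
      · rw [hc]; exact V.zero_mem
      · rw [hg, ← hs]; exact Submodule.subset_span hz
    · rw [map_zero]; exact V.zero_mem
    · intro y z _ _ hy hz
      rw [map_add]; exact V.add_mem hy hz
    · intro r y _ hy
      rw [← smul_residueMk]; exact V.smul_mem _ hy
  have hVN : ∀ v ∈ V, ∃ x ∈ N', residueMk K m x = v := by
    intro v hv
    rw [← hs] at hv
    refine Submodule.span_induction ?_ ?_ ?_ ?_ hv
    · exact fun y hy => ⟨g y, Submodule.subset_span (Or.inr ⟨y, hy, rfl⟩), hg y⟩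
    · exact ⟨0, N'.zero_mem, map_zero _⟩
    · rintro _ _ _ _ ⟨y, hy, rfl⟩ ⟨z, hz, rfl⟩
      exact ⟨y + z, N'.add_mem hy hz, map_add _ _ _⟩
    · rintro a _ _ ⟨y, hy, rfl⟩
      obtain ⟨r, rfl⟩ := Ideal.Quotient.mk_surjective a
      exact ⟨r • y, N'.smul_mem r hy, (smul_residueMk r y).symm⟩
  have hNfg : N.FG := Submodule.FG.map _
    (Submodule.fg_span ((s.finite_toSet.image g).insert c))
  set E := multiplierRing K m with hE
  have h1 : (1 : K) ∈ N * E := by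
    have h1 : (1 : K) = ((c + ∑ x ∈ s, g (f x) * g x : multiplierSubalgebra K m) : K) := by
      simp only [c, sub_add_cancel]
      rfl
    rw [h1, Subalgebra.coe_add, ← mul_one (c : K), AddSubmonoidClass.coe_finsetSum]
    refine Submodule.add_mem _ (Submodule.mul_mem_mul ((hNmem c).mpr
      (Submodule.subset_span (Set.mem_insert _ _))) one_mem_multiplierRing)
      (Submodule.sum_mem _ fun x hx => ?_)
    rw [Subalgebra.coe_mul, mul_comm (g (f x) : K)]
    exact Submodule.mul_mem_mul ((hNmem _).mpr (Submodule.subset_span (Or.inr ⟨x, hx, rfl⟩)))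
      (g (f x)).2
  have hEN : E ≤ N * E := by
    calc E = 1 * E := (one_mul E).symm
      _ ≤ N * E * E := mul_le_mul_left (Submodule.one_le.mpr h1) E
      _ = N * E := by rw [mul_assoc, multiplierRing_mul_self]
  have hdivE : ∀ G : Submodule R K, G * N ≤ E → G ≤ E := fun G hG => by
    calc G = G * 1 := (mul_one G).symm
      _ ≤ G * (N * E) := mul_le_mul_right (Submodule.one_le.mpr h1) G
      _ = G * N * E := (mul_assoc _ _ _).symm
      _ ≤ E * E := mul_le_mul_left hG E
      _ = E := multiplierRing_mul_self
  have hN0 : N ≠ ⊥ := by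
    intro h0
    rw [h0, Submodule.bot_mul, Submodule.mem_bot] at h1
    exact one_ne_zero h1
  have hF : N / N = 1 := by
    refine le_antisymm (fun z hz => ?_) (one_le_div_self N)
    have hzE : z ∈ E := hdivE (N / N) ((div_mul_le N N).trans hNE) hz
    let z' : multiplierSubalgebra K m := ⟨z, hzE⟩
    obtain ⟨a, ha⟩ := hVmul (residueMk K m z') fun v hv => by
      obtain ⟨x, hx, rfl⟩ := hVN v hv
      rw [← map_mul]
      exact hNV _ ((hNmem _).mp (mul_mem_of_mem_div hz ((hNmem x).mpr hx)))
    exact mem_one_of_residueMk_eq ha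
  have hinv : N * (1 / N) = 1 := by
    have := hS N hNE hN0 hNfg
    rwa [hF] at this
  have hGE : 1 / N ≤ E := hdivE _ ((div_mul_le 1 N).trans one_le_multiplierRing)
  -- some product `v * w` is a unit modulo `m`, and `v` is then a generator modulo `m`
  obtain ⟨v, hv, w, hw, r, hr, hvw⟩ : ∃ v ∈ N, ∃ w ∈ 1 / N, ∃ r ∉ m, v * w = algebraMap R K r := by
    by_contra! hcon
    have : N * (1 / N) ≤ coeSubmodule K m := Submodule.mul_le.mpr fun v hv w hw => by
      obtain ⟨r, hr⟩ := Submodule.mem_one.mp (hinv.le (Submodule.mul_mem_mul hv hw))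
      rw [← hr]
      refine algebraMap_mem_coeSubmodule.mpr ?_
      by_contra hrm
      exact hcon v hv w hw r hrm hr.symm
    rw [hinv] at this
    exact hm.ne_top (one_le_coeSubmodule_iff.mp this)
  let v' : multiplierSubalgebra K m := ⟨v, hNE hv⟩
  refine ⟨residueMk K m v', fun x hx => ?_⟩
  obtain ⟨u, hu, rfl⟩ := hVN x hx
  obtain ⟨t, ht⟩ := Submodule.mem_one.mp (mul_mem_of_mem_div hw ((hNmem u).mpr hu))
  obtain ⟨q, d, hd, hqd⟩ := hm.exists_inv hr
  refine Submodule.mem_span_singleton.mpr ⟨Ideal.Quotient.mk m (q * t), ?_⟩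
  rw [smul_residueMk, residueMk_eq_iff]
  have h2 : (((q * t) • v' : multiplierSubalgebra K m) : K) - u =
      -((u : K) * algebraMap R K d) := by
    have h3 : (((q * t) • v' : multiplierSubalgebra K m) : K) =
        algebraMap R K q * algebraMap R K t * v := by
      rw [← map_mul, ← Algebra.smul_def]; rfl
    have h4 : algebraMap R K q * algebraMap R K r + algebraMap R K d = 1 := by
      rw [← map_mul, ← map_add, hqd, map_one]
    rw [h3, ht]
    linear_combination (algebraMap R K q * u) * hvw + (u : K) * h4
  rw [h2]
  exact Submodule.neg_mem _ (mul_mem_of_mem_div u.2 (algebraMap_mem_coeSubmodule.mpr hd))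

end ResidueAlgebra

/-! ### Domains whose ideals are two-generated -/

section Dimension

variable {R : Type*} [CommRing R]

lemma isNoetherianRing_of_isTwoGenerated (h : ∀ I : Ideal R, IsTwoGenerated I) :
    IsNoetherianRing R := by
  refine ⟨fun I => ?_⟩
  obtain ⟨a, b, rfl⟩ := h I
  exact Submodule.fg_span (Set.toFinite _)

/-- If `m` and `m ^ 2` are generated by two elements, then `m ^ 2 = c m` locally at `m` for some
`c`: the products `a ^ 2`, `a b`, `b ^ 2` of two generators of `m` satisfy a linear relation
modulo `m ^ 3`, whose shape decides which of `a`, `b`, `a + b` may be taken. -/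
lemma exists_mul_self_le_span_mul {m : Ideal R} [hm : m.IsMaximal] (h1 : IsTwoGenerated m)
    (h2 : IsTwoGenerated (m * m)) :
    ∃ c ∈ m, m * m ≤ Ideal.span {c} * m ⊔ m • (m * m) := by
  obtain ⟨a, b, hab⟩ := h1
  obtain ⟨u, v, huv⟩ := h2
  have ha : a ∈ m := hab ▸ Ideal.subset_span (by simp)
  have hb : b ∈ m := hab ▸ Ideal.subset_span (by simp)
  have hu : u ∈ m * m := huv ▸ Ideal.subset_span (by simp)
  have hv : v ∈ m * m := huv ▸ Ideal.subset_span (by simp)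
  have hmem : ∀ c x : R, x ∈ m → c * x ∈ Ideal.span {c} * m ⊔ m • (m * m) := fun c x hx =>
    Submodule.mem_sup_left (Ideal.mul_mem_mul (Ideal.mem_span_singleton_self c) hx)
  have hle : ∀ N : Ideal R, a * a ∈ N → a * b ∈ N → b * b ∈ N → m * m ≤ N := by
    intro N haa hab' hbb
    rw [hab, Ideal.span_mul_span', Ideal.span_le]
    rintro _ ⟨x, (rfl | rfl), y, (rfl | rfl), rfl⟩
    · exact haa
    · exact hab'
    · change x * y ∈ N
      rwa [mul_comm]
    · exact hbb
  have hle' : ∀ c : R, m • (m * m) ≤ Ideal.span {c} * m ⊔ m • (m * m) := fun c => le_sup_right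
  by_cases h1 : a * b ∈ m • (m * m)
  · refine ⟨a + b, m.add_mem ha hb, hle _ ?_ (hle' _ h1) ?_⟩
    · have : a * a = (a + b) * a - a * b := by ring
      rw [this]
      exact Ideal.sub_mem _ (hmem _ _ ha) (hle' _ h1)
    · have : b * b = (a + b) * b - a * b := by ring
      rw [this]
      exact Ideal.sub_mem _ (hmem _ _ hb) (hle' _ h1)
  by_cases h2 : b * b ∈ Ideal.span {a * b} ⊔ m • (m * m)
  · refine ⟨a, ha, hle _ (hmem _ _ ha) (hmem _ _ hb) (?_ : b * b ∈ _)⟩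
    refine sup_le ?_ (hle' a) h2
    exact (Ideal.span_singleton_le_iff_mem _).mpr (hmem _ _ hb)
  · have huv' : m * m ≤ Ideal.span {u, v} ⊔ m • (m * m) := huv.le.trans le_sup_left
    have hgen := le_span_sup_span_of_le_span_pair hu hv huv' (Ideal.mul_mem_mul ha hb) h1
      (Ideal.mul_mem_mul hb hb) h2
    refine ⟨b, hb, hgen.trans (sup_le (sup_le ?_ ?_) (hle' b))⟩
    · rw [Ideal.span_singleton_le_iff_mem, mul_comm a b]
      exact hmem _ _ ha
    · exact (Ideal.span_singleton_le_iff_mem _).mpr (hmem _ _ hb)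

lemma dimensionLEOne_of_isTwoGenerated [IsDomain R] (h : ∀ I : Ideal R, IsTwoGenerated I) :
    Ring.DimensionLEOne R := by
  have := isNoetherianRing_of_isTwoGenerated h
  refine ⟨fun {P} hP0 hP => ?_⟩
  obtain ⟨m, hm, hPm⟩ := P.exists_le_maximal hP.ne_top
  obtain ⟨c, hc, hle⟩ := exists_mul_self_le_span_mul (h m) (h (m * m))
  obtain ⟨r, hr, hrle⟩ := Submodule.exists_sub_one_mem_and_smul_le_of_fg_of_le_sup
    (IsNoetherian.noetherian (m * m)) le_rfl hle
  have hrm : r ∉ m := fun hrm => hm.ne_top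
    ((Ideal.eq_top_iff_one _).mpr (by simpa using m.sub_mem hrm hr))
  have hmin : m ∈ (Ideal.span {c}).minimalPrimes := by
    refine ⟨⟨hm.isPrime, (Ideal.span_singleton_le_iff_mem _).mpr hc⟩, ?_⟩
    rintro q ⟨hq, hcq⟩ hqm x hx
    have h1 : r * (x * x) ∈ q := hcq (Ideal.mul_le_left
      (hrle (Submodule.smul_mem_pointwise_smul _ r _ (Ideal.mul_mem_mul hx hx))))
    have h2 := (hq.mem_or_mem h1).resolve_left fun h => hrm (hqm h)
    exact (hq.mem_or_mem h2).elim id id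
  have hheight : m.height ≤ 1 :=
    Ideal.height_le_one_of_isPrincipal_of_mem_minimalPrimes (Ideal.span {c}) m hmin
  by_contra hPmax
  have hlt : P < m := lt_of_le_of_ne hPm fun h => hPmax (h ▸ hm)
  have h3 := Ideal.height_strict_mono_of_isPrime hlt
  have h4 : P.height = 0 := by
    have := h3.trans_le hheight
    exact Order.lt_one_iff.mp this
  exact hP0 (Ideal.height_eq_zero_iff_eq_bot.mp h4)

end Dimension

section Covering

variable {R K : Type*} [CommRing R] [Field K] [Algebra R K] [IsFractionRing R K]

lemma wcovBy_one_div_of_mul_eq_one {m : Ideal R} [hm : m.IsMaximal]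
    (h : coeSubmodule K m * (1 / coeSubmodule K m) = 1) : 1 ⩿ 1 / coeSubmodule K m := by
  have key : ∀ B : Submodule R K, coeSubmodule K m * B = 1 → B = 1 / coeSubmodule K m := by
    intro B hB
    calc B = B * (coeSubmodule K m * (1 / coeSubmodule K m)) := by rw [h, mul_one]
      _ = (coeSubmodule K m * B) * (1 / coeSubmodule K m) := by ring
      _ = _ := by rw [hB, one_mul]
  refine ⟨Submodule.one_le_one_div.mpr (coeSubmodule_le_one m), fun B h1 h2 => ?_⟩
  have hle : coeSubmodule K m * B ≤ 1 := (mul_le_mul_right h2.le _).trans h.le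
  have hmle : coeSubmodule K m ≤ coeSubmodule K m * B := by
    simpa using mul_le_mul_right h1.le (coeSubmodule K m)
  obtain ⟨J, hJ⟩ : ∃ J : Ideal R, coeSubmodule K J = coeSubmodule K m * B :=
    ⟨_, coeSubmodule_comap hle⟩
  rw [← hJ] at hmle
  rcases eq_or_ne J ⊤ with rfl | hJ1
  · rw [IsLocalization.coeSubmodule_top, eq_comm] at hJ
    exact h2.ne (key B hJ)
  · rw [← hm.eq_of_le hJ1 (IsFractionRing.coeSubmodule_le_coeSubmodule.mp hmle)] at hJ
    apply h1.ne
    calc 1 = 1 / coeSubmodule K m * coeSubmodule K m := by rw [mul_comm, h]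
      _ = 1 / coeSubmodule K m * (coeSubmodule K m * B) := by rw [← hJ]
      _ = coeSubmodule K m * (1 / coeSubmodule K m) * B := by ring
      _ = B := by rw [h, one_mul]

lemma wcovBy_one_div_of_isTwoGenerated (h : ∀ I : Ideal R, IsTwoGenerated I) (m : Ideal R)
    [hm : m.IsMaximal] (hm0 : m ≠ ⊥) : 1 ⩿ 1 / coeSubmodule K m := by
  rcases mul_one_div_eq_one_or (K := K) m with hinv | hE
  · exact wcovBy_one_div_of_mul_eq_one hinv
  rw [hE]
  obtain ⟨c, hc, hc0⟩ := (Submodule.ne_bot_iff _).mp (coeSubmodule_ne_bot (K := K) hm0)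
  have hle : Submodule.span R {c} * multiplierRing K m ≤ 1 :=
    span_singleton_mul_le_one fun b hb => coeSubmodule_le_one m (by
      rw [mul_comm]; exact mul_mem_of_mem_div hb hc)
  obtain ⟨J, hJ⟩ : ∃ J : Ideal R, coeSubmodule K J = Submodule.span R {c} * multiplierRing K m :=
    ⟨_, coeSubmodule_comap hle⟩
  obtain ⟨a, b, rfl⟩ := h J
  refine wcovBy_multiplierRing_of_eq_span_pair (u := c⁻¹ * algebraMap R K a)
    (v := c⁻¹ * algebraMap R K b) (span_singleton_mul_left_cancel hc0 ?_)
  rw [← hJ, IsLocalization.coeSubmodule_span, Submodule.span_mul_span, Set.image_pair,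
    Set.singleton_mul, Set.image_pair, mul_inv_cancel_left₀ hc0, mul_inv_cancel_left₀ hc0]

/-- Dualizing preserves the relation "no module lies strictly between", when it holds for the
inclusions `R ≤ m⁻¹`. The annihilator `m` of the simple module `X / Y`, generated by the class
of `a`, is maximal, and `x ↦ a x` embeds `Y⁻¹ / X⁻¹` into `m⁻¹ / R`. -/
lemma wcovBy_one_div_one_div
    (h : ∀ m : Ideal R, m.IsMaximal → m ≠ ⊥ → 1 ⩿ 1 / coeSubmodule K m) {X Y : Submodule R K}
    (hY : Y ≠ ⊥) (hYX : Y ⩿ X) : 1 / X ⩿ 1 / Y := by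
  by_cases hXY : X ≤ Y
  · rw [le_antisymm hXY hYX.le]
    exact WCovBy.rfl
  obtain ⟨a, haX, haY⟩ := SetLike.not_le_iff_exists.mp hXY
  have hgen : ∀ b ∈ X, b ∉ Y → Y ⊔ Submodule.span R {b} = X := fun b hbX hbY =>
    (hYX.eq_or_eq le_sup_left (sup_le hYX.le
      ((Submodule.span_singleton_le_iff_mem _ _).mpr hbX))).resolve_left fun h' =>
        hbY (sup_eq_left.mp h' (Submodule.mem_span_singleton_self b))
  let m : Ideal R := Y.comap (LinearMap.toSpanSingleton R K a)
  have hmem : ∀ r : R, r ∈ m ↔ r • a ∈ Y := fun r => Iff.rfl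
  have hm : m.IsMaximal := by
    rw [Ideal.isMaximal_iff]
    refine ⟨by rwa [hmem, one_smul], fun J x hJ hxm hxJ => ?_⟩
    have haX' : a ∈ Y ⊔ Submodule.span R {x • a} :=
      (hgen (x • a) (X.smul_mem x haX) hxm).ge haX
    obtain ⟨y, hy, z, hz, hyz⟩ := Submodule.mem_sup.mp haX'
    obtain ⟨t, rfl⟩ := Submodule.mem_span_singleton.mp hz
    have h1 : 1 - t * x ∈ m := by
      rw [hmem, sub_smul, one_smul, mul_smul]
      rwa [← eq_sub_of_add_eq hyz]
    simpa using J.add_mem (hJ h1) (J.mul_mem_left t hxJ)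
  have hm0 : m ≠ ⊥ := by
    obtain ⟨y, hy0, hy⟩ := exists_algebraMap_mem_ne_zero hY
    obtain ⟨p, q, hq, rfl⟩ := IsFractionRing.div_surjective (A := R) a
    have hq0 : algebraMap R K q ≠ 0 := fun h0 => haY (by rw [h0, div_zero]; exact Y.zero_mem)
    have hy0' : algebraMap R K y ≠ 0 := fun h0 =>
      hy0 ((IsFractionRing.to_map_eq_zero_iff (K := K)).mp h0)
    refine (Submodule.ne_bot_iff _).mpr ⟨q * y, ?_, fun h0 => ?_⟩
    · rw [hmem, Algebra.smul_def, map_mul]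
      have : algebraMap R K q * algebraMap R K y * (algebraMap R K p / algebraMap R K q) =
          algebraMap R K p * algebraMap R K y := by field_simp
      rw [this]
      exact algebraMap_mul_mem _ _ hy
    · have := congrArg (algebraMap R K) h0
      rw [map_mul, map_zero] at this
      exact (mul_eq_zero.mp this).elim hq0 hy0'
  have hXle : ∀ x : K, a * x ∈ (1 : Submodule R K) → x ∈ 1 / Y → x ∈ 1 / X := by
    intro x hax hx y hy
    rw [← hgen a haX haY] at hy
    obtain ⟨y', hy', z, hz, rfl⟩ := Submodule.mem_sup.mp hy
    obtain ⟨t, rfl⟩ := Submodule.mem_span_singleton.mp hz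
    rw [mul_add, mul_smul_comm, mul_comm x a]
    exact Submodule.add_mem _ (mul_mem_of_mem_div hx hy') (Submodule.smul_mem _ t hax)
  have hdual : ∀ x ∈ 1 / Y, a * x ∈ 1 / coeSubmodule K m := by
    intro x hx y hy
    obtain ⟨r, hr, rfl⟩ := (IsLocalization.mem_coeSubmodule K m).mp hy
    have : a * x * algebraMap R K r = x * (r • a) := by rw [Algebra.smul_def]; ring
    rw [this]
    exact mul_mem_of_mem_div hx ((hmem r).mp hr)
  refine ⟨div_anti 1 hYX.le, fun B h1 h2 => ?_⟩
  rcases (h m hm hm0).eq_or_eq (c := 1 ⊔ Submodule.span R {a} * B) le_sup_left (by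
    refine sup_le (Submodule.one_le_one_div.mpr (coeSubmodule_le_one m)) fun x hx => ?_
    obtain ⟨b, hb, rfl⟩ := mem_span_singleton_mul_iff.mp hx
    exact hdual b (h2.le hb)) with hB | hB
  · refine h1.not_ge fun b hb => hXle b (sup_eq_left.mp hB ?_) (h2.le hb)
    exact Submodule.mul_mem_mul (Submodule.mem_span_singleton_self a) hb
  · refine h2.not_ge fun x hx => ?_
    obtain ⟨r, hr, z, hz, hrz⟩ := Submodule.mem_sup.mp (hB.ge (hdual x hx))
    obtain ⟨b, hb, rfl⟩ := mem_span_singleton_mul_iff.mp hz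
    have : x - b ∈ B := h1.le (hXle (x - b) (by rwa [mul_sub, ← hrz, add_sub_cancel_right])
      (Submodule.sub_mem _ hx (h2.le hb)))
    simpa using B.add_mem this hb

/-- Starting from a principal ideal, divisoriality climbs up a chain of ideals with simple
quotients. -/
lemma isDivisorialDomain_of_wcovBy [IsDomain R] [IsNoetherianRing R] [Ring.DimensionLEOne R]
    (h : ∀ m : Ideal R, m.IsMaximal → m ≠ ⊥ → 1 ⩿ 1 / coeSubmodule K m) :
    IsDivisorialDomain R K := by
  intro I hI
  obtain ⟨x, hxI, hx0⟩ := I.ne_bot_iff.mp hI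
  have hx0K : algebraMap R K x ≠ 0 := fun h0 =>
    hx0 ((IsFractionRing.to_map_eq_zero_iff (K := K)).mp h0)
  have hart : IsArtinianRing (R ⧸ Ideal.span {x}) := by
    have : Ring.KrullDimLE 0 (R ⧸ Ideal.span {x}) := Ring.krullDimLE_zero_iff.mpr fun J hJ => by
      have hx : x ∈ J.comap (Ideal.Quotient.mk (Ideal.span {x})) := by
        rw [Ideal.mem_comap, Ideal.Quotient.eq_zero_iff_mem.mpr (Ideal.mem_span_singleton_self x)]
        exact J.zero_mem
      have hmax : (J.comap (Ideal.Quotient.mk (Ideal.span {x}))).IsMaximal :=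
        (hJ.comap _).isMaximal fun h0 => hx0 (by simpa [h0] using hx)
      rw [← Ideal.map_comap_of_surjective _ Ideal.Quotient.mk_surjective J]
      exact (Ideal.map_eq_top_or_isMaximal_of_surjective _ Ideal.Quotient.mk_surjective
        hmax).resolve_left (by
          rw [Ideal.map_comap_of_surjective _ Ideal.Quotient.mk_surjective]; exact hJ.ne_top)
    exact isArtinianRing_iff_isNoetherianRing_krullDimLE_zero.mpr ⟨inferInstance, this⟩
  have hart' : IsArtinian R (R ⧸ Ideal.span {x}) :=
    isArtinian_of_surjective_algebraMap
      (Ideal.Quotient.mk_surjective (I := Ideal.span {x}))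
  have hwf : WellFoundedLT (Set.Ici (Ideal.span {x})) :=
    (Submodule.comapMkQRelIso (Ideal.span {x})).symm.toOrderEmbedding.wellFoundedLT
  obtain ⟨I', hI'⟩ : ∃ I' : Set.Ici (Ideal.span {x}), (I' : Ideal R) = I :=
    ⟨⟨I, (Ideal.span_singleton_le_iff_mem _).mpr hxI⟩, rfl⟩
  clear hxI hI
  induction I' using hwf.induction generalizing I with
  | _ I' ih =>
  subst hI'
  by_cases hIx : (I' : Ideal R) ≤ Ideal.span {x}
  · have : (I' : Ideal R) = Ideal.span {x} := le_antisymm hIx I'.2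
    rw [this, IsDivisorialIdeal, IsLocalization.coeSubmodule_span_singleton]
    have h1 := one_div_span_singleton_mul (R := R) hx0K 1
    have h2 := one_div_span_singleton_mul (R := R) (inv_ne_zero hx0K) 1
    rw [div_one_eq, mul_one, mul_one] at h1 h2
    rw [h1, h2, inv_inv]
  · -- a maximal element `J` among the ideals strictly between
    obtain ⟨J, ⟨hxJ, hJI⟩, hJmax⟩ := set_has_maximal_iff_noetherian.mpr ‹IsNoetherianRing R›
      {J : Ideal R | Ideal.span {x} ≤ J ∧ J < I'} ⟨Ideal.span {x}, le_rfl,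
        lt_of_le_of_ne I'.2 fun h => hIx h.ge⟩
    have hJdiv : IsDivisorialIdeal K J := ih ⟨J, hxJ⟩ hJI J rfl
    have hcov : coeSubmodule K J ⩿ coeSubmodule K (I' : Ideal R) := by
      refine ⟨IsLocalization.coeSubmodule_mono K hJI.le, fun B h1 h2 => ?_⟩
      obtain ⟨L, rfl⟩ : ∃ L : Ideal R, coeSubmodule K L = B :=
        ⟨_, coeSubmodule_comap (h2.le.trans (coeSubmodule_le_one _))⟩
      have h1' : J < L := lt_of_le_not_ge (IsFractionRing.coeSubmodule_le_coeSubmodule.mp h1.le)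
        fun h' => h1.not_ge (IsLocalization.coeSubmodule_mono K h')
      have h2' : L < I' := lt_of_le_not_ge (IsFractionRing.coeSubmodule_le_coeSubmodule.mp h2.le)
        fun h' => h2.not_ge (IsLocalization.coeSubmodule_mono K h')
      exact hJmax L ⟨hxJ.trans h1'.le, h2'⟩ h1'
    have hJ0 : J ≠ ⊥ := fun h0 => hx0 (by
      simpa [h0] using hxJ (Ideal.mem_span_singleton_self x))
    have hI0 : 1 / coeSubmodule K (I' : Ideal R) ≠ ⊥ := fun h0 => by
      have : (1 : K) ∈ 1 / coeSubmodule K (I' : Ideal R) :=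
        Submodule.one_mem_div.mpr (coeSubmodule_le_one _)
      rw [h0, Submodule.mem_bot] at this
      exact one_ne_zero this
    have hcov2 := wcovBy_one_div_one_div h hI0
      (wcovBy_one_div_one_div h (coeSubmodule_ne_bot hJ0) hcov)
    rw [IsDivisorialIdeal] at hJdiv
    rw [hJdiv] at hcov2
    refine ((hcov2.eq_or_eq hcov.le (le_one_div_one_div _)).resolve_left fun h' => ?_).symm
    exact hJI.ne (coeSubmodule_injective h'.symm)

end Covering

/-! ### Finitely stable Mori domains -/

section FinitelyStable

variable {R K : Type*} [CommRing R] [Field K] [Algebra R K] [IsFractionRing R K]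

lemma _root_.IsFinitelyStableDomain.mul_div_div_eq (hS : IsFinitelyStableDomain R K)
    {N : Submodule R K} (hN0 : N ≠ ⊥) (hN : N.FG) {d : K} (hd : d ≠ 0)
    (h : ∀ x ∈ N, d * x ∈ (1 : Submodule R K)) : N * (N / N / N) = N / N := by
  have hle := span_singleton_mul_le_one h
  obtain ⟨J, hJ⟩ : ∃ J : Ideal R, coeSubmodule K J = Submodule.span R {d} * N :=
    ⟨_, coeSubmodule_comap hle⟩
  have hJ0 : J ≠ ⊥ := by
    rintro rfl
    rw [IsLocalization.coeSubmodule_bot] at hJ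
    exact span_singleton_mul_ne_bot hd hN0 hJ.symm
  have hJfg : J.FG := by
    refine (IsLocalization.coeSubmodule_fg K (IsFractionRing.injective R K) J).mp ?_
    rw [hJ]
    exact Submodule.FG.mul (Submodule.fg_span_singleton d) hN
  have hU : Submodule.span R {d} * Submodule.span R {d⁻¹} = 1 := span_mul_span_inv hd
  set U := Submodule.span R {d}
  set V := Submodule.span R {d⁻¹}
  have hself : U * N / (U * N) = N / N := by
    apply le_antisymm
    · rw [Submodule.le_div_iff_mul_le]
      calc U * N / (U * N) * N = V * (U * N / (U * N) * (U * N)) := by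
            have : V * (U * N / (U * N) * (U * N)) = U * V * (U * N / (U * N) * N) := by ring
            rw [this, hU, one_mul]
        _ ≤ V * (U * N) := mul_le_mul_right (div_mul_le _ _) V
        _ = N := by rw [← mul_assoc, mul_comm V, hU, one_mul]
    · rw [Submodule.le_div_iff_mul_le, mul_left_comm]
      exact mul_le_mul_right (div_mul_le _ _) U
  have := hS J hJ0 hJfg
  rw [IsStableIdeal, hJ, hself, div_mul_of_mul_eq_one hU] at this
  calc N * (N / N / N) = U * V * (N * (N / N / N)) := by rw [hU, one_mul]
    _ = U * N * (V * (N / N / N)) := by ring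
    _ = N / N := this

/-- A maximal ideal `m` with `m⁻¹ = (m : m)` is generated over `(m : m)` by an ideal `J` of finite
type with `J⁻¹ = m⁻¹`, and it is invertible in `(m : m)` because `J` is stable. -/
lemma exists_fg_eq_mul_multiplierRing (hS : IsFinitelyStableDomain R K) (hM : IsMoriDomain R K)
    {m : Ideal R} (hm0 : m ≠ ⊥) (hE : 1 / coeSubmodule K m = multiplierRing K m) :
    (∃ J : Ideal R, J.FG ∧ coeSubmodule K m = coeSubmodule K J * multiplierRing K m) ∧
      coeSubmodule K m * (multiplierRing K m / coeSubmodule K m) = multiplierRing K m := by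
  obtain ⟨J, hJ0, hJfg, hJm, hJ⟩ := hM.exists_fg_one_div_eq hm0
  have hstab := hS J hJ0 hJfg
  rw [IsStableIdeal] at hstab
  have hJmK := IsLocalization.coeSubmodule_mono K hJm
  have hEE : multiplierRing K m * multiplierRing K m = multiplierRing K m :=
    multiplierRing_mul_self
  have hEm : multiplierRing K m * coeSubmodule K m = coeSubmodule K m :=
    multiplierRing_mul_coeSubmodule
  have h1E : (1 : Submodule R K) ≤ multiplierRing K m := one_le_multiplierRing
  have hFE : coeSubmodule K J / coeSubmodule K J ≤ multiplierRing K m := by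
    rw [← hE, ← hJ]
    exact div_mono_left _ (coeSubmodule_le_one J)
  have h1F : 1 ≤ coeSubmodule K J / coeSubmodule K J := one_le_div_self _
  set E := multiplierRing K m
  set N := coeSubmodule K m
  set F := coeSubmodule K J / coeSubmodule K J
  set H := F / coeSubmodule K J * E with hH
  have hJH : coeSubmodule K J * H = E := by
    rw [hH, ← mul_assoc, hstab]
    apply le_antisymm
    · exact (mul_le_mul_left hFE E).trans hEE.le
    · simpa using mul_le_mul_left h1F E
  have hHE : H ≤ E / N := by
    have h1 : E / N = E / coeSubmodule K J := by
      rw [← hE, div_div_comm 1 N (coeSubmodule K J), hJ]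
    rw [h1, Submodule.le_div_iff_mul_le, mul_comm, hJH]
  refine ⟨⟨J, hJfg, le_antisymm ?_ ?_⟩, le_antisymm ?_ ?_⟩
  · calc N ≤ N * E := by simpa using mul_le_mul_right h1E N
      _ = coeSubmodule K J * (H * N) := by rw [← hJH]; ring
      _ ≤ coeSubmodule K J * E :=
        mul_le_mul_right (Submodule.le_div_iff_mul_le.mp hHE) _
  · rw [mul_comm]
    exact (mul_le_mul_right hJmK E).trans hEm.le
  · rw [mul_comm]
    exact div_mul_le _ _
  · exact hJH.ge.trans ((mul_le_mul_left hJmK H).trans (mul_le_mul_right hHE N))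

lemma _root_.IsFinitelyStableDomain.isStableQuadratic (hR : IsSeminormalDomain R K)
    (hS : IsFinitelyStableDomain R K) (hM : IsMoriDomain R K) (m : Ideal R) [hm : m.IsMaximal]
    (hm0 : m ≠ ⊥) : IsStableQuadratic K m := by
  rcases mul_one_div_eq_one_or (K := K) m with h | h
  · exact isStableQuadratic_of_mul_one_div_eq_one h
  refine ⟨(exists_fg_eq_mul_multiplierRing hS hM hm0 h).2, ?_⟩
  obtain ⟨c, hc, hc0⟩ := (Submodule.ne_bot_iff _).mp (coeSubmodule_ne_bot (K := K) hm0)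
  have hred := isReduced_residueAlgebra (K := K) (m := m)
    fun y hy hy2 => isReduced_of_isSeminormalDomain hR hy hy2
  let := Ideal.Quotient.field m
  have hlines := linesOfTrivialMultipliers_residueAlgebra (K := K) (m := m)
    fun N hNE hN0 hN => hS.mul_div_div_eq hN0 hN hc0 fun x hx => coeSubmodule_le_one m (by
      rw [mul_comm]; exact mul_mem_of_mem_div (hNE hx) hc)
  exact wcovBy_multiplierRing fun y z hy =>
    exists_eq_add_mul_of_linesOfTrivialMultipliers hlines hy z

lemma _root_.IsFinitelyStableDomain.fg_of_isMaximal (hR : IsSeminormalDomain R K)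
    (hS : IsFinitelyStableDomain R K) (hM : IsMoriDomain R K) (m : Ideal R) [hm : m.IsMaximal]
    (hm0 : m ≠ ⊥) : m.FG := by
  refine (IsLocalization.coeSubmodule_fg K (IsFractionRing.injective R K) m).mp ?_
  rcases mul_one_div_eq_one_or (K := K) m with h | h
  · exact Submodule.fg_of_isUnit (IsUnit.of_mul_eq_one _ h)
  obtain ⟨⟨J, hJ, hmJ⟩, -⟩ := exists_fg_eq_mul_multiplierRing hS hM hm0 h
  obtain ⟨y, -, hy⟩ := exists_eq_sup_span_of_wcovBy (hS.isStableQuadratic hR hM m hm0).wcovBy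
  have hJ' : (coeSubmodule K J).FG :=
    (IsLocalization.coeSubmodule_fg K (IsFractionRing.injective R K) J).mpr hJ
  have hfg1 : (1 : Submodule R K).FG := by
    rw [Submodule.one_eq_span]
    exact Submodule.fg_span_singleton 1
  rw [hmJ, hy]
  exact hJ'.mul (hfg1.sup (Submodule.fg_span_singleton y))

/-- A Mori domain whose maximal ideals satisfy the local condition has dimension at most one.
For a nonzero prime `P` strictly inside `m`, the prime ideal `Q = (P : m)` of `E = (m : m)` lies in
the proper ideal `A = Q + m`, which is invertible; then `Q = A Q`, so that `Q` is contained in all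
powers of `A`. The inverses of the powers of `A` are thus divisorial with a common denominator. -/
lemma _root_.IsMoriDomain.dimensionLEOne (hR : IsSeminormalDomain R K) (hM : IsMoriDomain R K)
    (h : ∀ m : Ideal R, m.IsMaximal → m ≠ ⊥ → IsStableQuadratic K m) : Ring.DimensionLEOne R := by
  refine ⟨fun {P} hP0 hP => ?_⟩
  obtain ⟨m, hm, hPm⟩ := P.exists_le_maximal hP.ne_top
  by_contra hPmax
  have hmP : ¬ m ≤ P := fun hle => hPmax (le_antisymm hPm hle ▸ hm)
  obtain ⟨c, hcm, hcP⟩ := SetLike.not_le_iff_exists.mp hmP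
  obtain ⟨p, hp, hp0⟩ := P.ne_bot_iff.mp hP0
  have hm0 : m ≠ ⊥ := ne_bot_of_le_ne_bot hP0 hPm
  have hgood := h m hm hm0
  have hp0K : algebraMap R K p ≠ 0 := fun h0 =>
    hp0 ((IsFractionRing.to_map_eq_zero_iff (K := K)).mp h0)
  have hEE : multiplierRing K m * multiplierRing K m = multiplierRing K m :=
    multiplierRing_mul_self
  have hEm : multiplierRing K m * coeSubmodule K m = coeSubmodule K m :=
    multiplierRing_mul_coeSubmodule
  have h1E : (1 : Submodule R K) ≤ multiplierRing K m := one_le_multiplierRing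
  have hmE : coeSubmodule K m ≤ multiplierRing K m := coeSubmodule_le_multiplierRing
  have hPmK := IsLocalization.coeSubmodule_mono K hPm
  set Q := coeSubmodule K P / coeSubmodule K m with hQ
  have hQE : Q ≤ multiplierRing K m := div_mono_left _ hPmK
  have hQR : ∀ r : R, algebraMap R K r ∈ Q → r ∈ P := by
    intro r hr
    have := mul_mem_of_mem_div hr (algebraMap_mem_coeSubmodule.mpr hcm)
    rw [← map_mul, algebraMap_mem_coeSubmodule] at this
    exact (hP.mem_or_mem this).resolve_right hcP
  have hPQ : algebraMap R K p ∈ Q := fun y hy => by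
    obtain ⟨r, -, rfl⟩ := (IsLocalization.mem_coeSubmodule K m).mp hy
    rw [← map_mul]
    exact algebraMap_mem_coeSubmodule.mpr (P.mul_mem_right r hp)
  have hEQ : multiplierRing K m * Q ≤ Q := by
    rw [hQ, Submodule.le_div_iff_mul_le, mul_comm _ (_ / _), mul_assoc, hEm]
    exact div_mul_le _ _
  have hA1 : (1 : K) ∉ Q ⊔ coeSubmodule K m := by
    intro h1
    obtain ⟨q, hq, x, hxK, hqx⟩ := Submodule.mem_sup.mp h1
    obtain ⟨x, hx, rfl⟩ := (IsLocalization.mem_coeSubmodule K m).mp hxK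
    have hq' : algebraMap R K (1 - x) ∈ Q := by
      rw [map_sub, map_one, ← hqx, add_sub_cancel_right]
      exact hq
    apply hm.ne_top ((Ideal.eq_top_iff_one _).mpr _)
    simpa using m.add_mem (hPm (hQR _ hq')) hx
  have hAE : Q ⊔ coeSubmodule K m ≤ multiplierRing K m := sup_le hQE hmE
  obtain ⟨A', hAA'⟩ := exists_mul_eq_of_wcovBy hgood.wcovBy
    (fun y hy hy2 => isReduced_of_isSeminormalDomain hR hy hy2) le_sup_right hAE (by
      rw [Submodule.mul_sup]; exact sup_le_sup hEQ hEm.le)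
  obtain ⟨D, hD⟩ : ∃ D : Submodule R K, 1 / D = multiplierRing K m := by
    rcases mul_one_div_eq_one_or (K := K) m with h | h
    · exact ⟨1, by rw [div_one_eq, multiplierRing_eq_one_of_mul_eq_one h]⟩
    · exact ⟨_, h⟩
  have hinv := hgood.invertible
  have hQA : Q ≤ Q ⊔ coeSubmodule K m := le_sup_left
  have hmA : coeSubmodule K m ≤ Q ⊔ coeSubmodule K m := le_sup_right
  set E := multiplierRing K m
  set N := coeSubmodule K m
  set A := Q ⊔ N
  set B := A' * (E / N) with hB
  have hAB : A * B = E := by rw [hB, ← mul_assoc, hAA', hinv]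
  have hEB : E * B ≤ B := by
    rw [hB, mul_left_comm]
    refine mul_le_mul_right ?_ A'
    rw [Submodule.le_div_iff_mul_le, mul_assoc]
    exact (mul_le_mul_right (div_mul_le _ _) E).trans hEE.le
  have h1B : 1 ≤ B := h1E.trans (hAB.ge.trans ((mul_le_mul_left hAE B).trans hEB))
  have hQB : Q * B ≤ Q := by
    rw [hQ, Submodule.le_div_iff_mul_le, ← hQ]
    intro x hx
    have hxQ : x ∈ Q := by
      have : Q * B * N ≤ Q := by
        calc Q * B * N ≤ Q * B * A := mul_le_mul_right hmA _
          _ = E * Q := by rw [mul_assoc, mul_comm B, hAB, mul_comm]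
          _ ≤ Q := hEQ
      exact this hx
    have hx1 : x ∈ (1 : Submodule R K) := by
      have : Q * B * N ≤ 1 := by
        calc Q * B * N ≤ A * B * N := mul_le_mul_left (mul_le_mul_left hQA B) N
          _ = N := by rw [hAB, hEm]
          _ ≤ 1 := coeSubmodule_le_one m
      exact this hx
    obtain ⟨r, rfl⟩ := Submodule.mem_one.mp hx1
    exact algebraMap_mem_coeSubmodule.mpr (hQR r hxQ)
  -- the inverses `C n` of the powers of `A`
  let C : ℕ → Submodule R K := fun n => E * B ^ n
  have hC0 : C 0 = E := by simp [C]
  have hCs : ∀ n, C (n + 1) = C n * B := fun n => by simp only [C, pow_succ, mul_assoc]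
  have hEC : ∀ n, E * C n = C n := fun n => by simp only [C, ← mul_assoc, hEE]
  have hAC : ∀ n, A ^ n * C n = E := by
    intro n
    induction n with
    | zero => rw [pow_zero, one_mul, hC0]
    | succ n ih =>
      calc A ^ (n + 1) * C (n + 1) = (A ^ n * C n) * (A * B) := by rw [hCs, pow_succ]; ring
        _ = E := by rw [ih, hAB, hEE]
  have hCdiv : ∀ n, C n = 1 / (D * A ^ n) := by
    intro n
    rw [← div_div_eq, hD]
    apply le_antisymm
    · rw [Submodule.le_div_iff_mul_le, mul_comm, hAC]
    · calc E / A ^ n ≤ E / A ^ n * E := by simpa using mul_le_mul_right h1E (E / A ^ n)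
        _ = E / A ^ n * A ^ n * C n := by rw [mul_assoc, hAC]
        _ ≤ E * C n := mul_le_mul_left (div_mul_le _ _) _
        _ = C n := hEC n
  have hCdd : ∀ n, 1 / (1 / C n) = C n := fun n => by
    rw [hCdiv, one_div_one_div_one_div]
  have hCmono : Monotone C := monotone_nat_of_le_succ fun n => by
    rw [hCs]; simpa using mul_le_mul_right h1B (C n)
  have hQC : ∀ n, Q * C n ≤ Q := by
    intro n
    induction n with
    | zero => rw [hC0, mul_comm]; exact hEQ
    | succ n ih =>
      rw [hCs, ← mul_assoc]
      exact (mul_le_mul_left ih B).trans hQB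
  obtain ⟨n, hn⟩ := hM.exists_forall_one_div_eq (X := fun n => 1 / C n)
    (fun i j hij => div_anti 1 (hCmono hij)) (mul_ne_zero hp0K hp0K) (fun n y hy => by
      rw [hCdd] at hy
      have h1 : algebraMap R K p * y ∈ Q := hQC n (Submodule.mul_mem_mul hPQ hy)
      have h2 := mul_mem_of_mem_div h1 (algebraMap_mem_coeSubmodule.mpr (hPm hp))
      have h3 : algebraMap R K p * algebraMap R K p * y =
          algebraMap R K p * y * algebraMap R K p := by ring
      rw [h3]
      exact coeSubmodule_le_one P h2)
    (fun n h0 => by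
      rw [hCdd] at h0
      have : (1 : K) ∈ C n := hCmono (Nat.zero_le n) (hC0 ▸ Submodule.one_le.mp h1E)
      rw [h0, Submodule.mem_bot] at this
      exact one_ne_zero this)
  have hstab := hn (n + 1) n.le_succ
  rw [hCdd, hCdd] at hstab
  have hAeq : E = A * E := by
    calc E = A ^ (n + 1) * C (n + 1) := (hAC (n + 1)).symm
      _ = A * (A ^ n * C n) := by rw [hstab, pow_succ]; ring
      _ = A * E := by rw [hAC]
  have hAEA : A * E ≤ A := by
    rw [mul_comm, Submodule.mul_sup]
    exact sup_le_sup hEQ hEm.le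
  exact hA1 (hAEA (hAeq ▸ Submodule.one_le.mp h1E))

lemma _root_.IsFinitelyStableDomain.isNoetherianRing (hR : IsSeminormalDomain R K)
    (hS : IsFinitelyStableDomain R K) (hM : IsMoriDomain R K) : IsNoetherianRing R := by
  have := hM.dimensionLEOne hR fun m _ hm0 => hS.isStableQuadratic hR hM m hm0
  refine IsNoetherianRing.of_prime_ne_bot fun P hP hP0 => ?_
  have := hP.isMaximal hP0
  exact hS.fg_of_isMaximal hR hM P hP0

end FinitelyStable
end DivisorialStable

/-! ### The three characterizations -/

open DivisorialStable in
theorem theorem3p6 (R K : Type*) [CommRing R] [IsDomain R] [Field K] [Algebra R K]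
    [IsFractionRing R K] (hR : IsSeminormalDomain R K) :
    List.TFAE [
      ∀ I : Ideal R, IsTwoGenerated I,
      IsDivisorialDomain R K ∧ IsMoriDomain R K,
      IsFinitelyStableDomain R K ∧ IsMoriDomain R K] := by
  tfae_have 1 → 2 := fun h => by
    have := isNoetherianRing_of_isTwoGenerated h
    have := dimensionLEOne_of_isTwoGenerated h
    exact ⟨isDivisorialDomain_of_wcovBy fun m _ hm0 => wcovBy_one_div_of_isTwoGenerated h m hm0,
      isMoriDomain_of_isNoetherianRing⟩
  tfae_have 2 → 3 := fun ⟨hD, hM⟩ => by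
    have := isNoetherianRing_of_isDivisorialDomain hD hM
    exact ⟨fun I hI _ => isStableIdeal_of_isStableQuadratic hR
      (fun m _ hm0 => hD.isStableQuadratic hR m hm0) hI, hM⟩
  tfae_have 3 → 1 := fun ⟨hS, hM⟩ => by
    have hgood : ∀ m : Ideal R, m.IsMaximal → m ≠ ⊥ → IsStableQuadratic K m :=
      fun m _ hm0 => hS.isStableQuadratic hR hM m hm0
    have := hS.isNoetherianRing hR hM
    have := hM.dimensionLEOne hR hgood
    intro I
    by_cases hI : I = ⊥
    · exact ⟨0, 0, by simp [hI]⟩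
    by_cases hfield : IsField R
    · let := hfield.toField
      refine ⟨1, 0, ?_⟩
      rw [(Ideal.eq_bot_or_top I).resolve_left hI, eq_comm, Ideal.eq_top_iff_one]
      exact Ideal.subset_span (by simp)
    refine isTwoGenerated_of_forall_isMaximal hI fun m hm => ?_
    have hm0 : m ≠ ⊥ := Ring.ne_bot_of_isMaximal_of_not_isField hm hfield
    exact exists_le_span_pair_sup_smul hR hm0 (hgood m hm hm0) hI
  tfae_finish
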